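/- Let $\theta>0$, $a>-1$, $b>-1$ with $a+b+1>0$, and put $\alpha=(a+b+1)/\theta-1$ (so $\alpha>-1$) and $h_n=\theta/(2n\theta+a+b+1)$. Let $(\hat P_n)_{n\ge0}$, $(\hat Q_n)_{n\ge 0}$ be $\theta$-deformed Cauchy bi-orthogonal polynomials with Laguerre weight, that is, real polynomials with $\deg\hat P_n=\deg\hat Q_n=n$ and $$\int_0^\infty\!\!\int_0^\infty \frac{e^{-(x+y)}}{x+y}\,x^a y^b\,\hat P_n(x^\theta)\,\hat Q_m(y^\theta)\,dx\,dy=\frac{h_n}{\theta}\,\delta_{n,m}\qquad(n,m\ge 0);$$ such families exist. Let $$K_N(x,y)=\sum_{n=0}^{N-1}\frac{\theta}{h_n}\,\hat P_n(x^\theta)\,\hat Q_n(y^\theta)$$ be their Christoffel–Darboux kernel. For $c>-1$ and complex $z\neq0$ let $$G^\theta_{\infty,c}(z)=\int_\gamma\frac{du}{2\pi i}\,\frac{\Gamma(u)\,z^{-u}}{\Gamma(\alpha-u+1)\,\Gamma(c-\theta u+1)},$$ where $\gamma$ is any loop $-\infty+i\varphi_1\to\delta+i\varphi_1\to\delta+i\varphi_2\to-\infty+i\varphi_2$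 with $\varphi_1<0<\varphi_2$ and $\delta>0$, which thus encloses the negative real axis and the origin once, counterclockwise. Then this integral converges absolutely, $$G^\theta_{\infty,c}(z)=\sum_{k=0}^\infty\frac{(-1)^k z^k}{k!\,\Gamma(\alpha+k+1)\,\Gamma(c+\theta k+1)},$$ and $G^\theta_{\infty,c}$ is the Fox H-function $$G^\theta_{\infty,c}(z)=H^{1,0}_{0,3}\!\left[z\,\middle|\,\begin{matrix}-\\(0,1);\,(-\alpha,1);\,(-c,\theta)\end{matrix}\right],$$ where $$H^{m,n}_{p,q}\!\left[z\,\middle|\,\begin{matrix}(a_1,A_1);\ldots;(a_p,A_p)\\(b_1,B_1);\ldots;(b_q,B_q)\end{matrix}\right]=\frac1{2\pi i}\int_\gamma\frac{\prod_{j=1}^m\Gamma(b_j+B_js)\prod_{j=1}^n\Gamma(1-a_j-A_js)}{\prod_{j=m+1}^q\Gamma(1-b_j-B_js)\prod_{j=n+1}^p\Gamma(a_j+A_js)}\,z^{-s}\,ds,$$ with $\gamma$ enclosing the poles of the $\Gamma(b_j+B_js)$, $j\le m$, and none of those of the $\Gamma(1-a_j-A_js)$, $j\le n$. Moreover, for all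 $X,Y>0$ the integral on the right below converges absolutely and $$\lim_{N\to\infty}N^{-2(\alpha+1)}\,K_N\!\left(\frac{X}{N^{2/\theta}},\frac{Y}{N^{2/\theta}}\right)=\theta\int_0^1 t^\alpha\,G^\theta_{\infty,a}(tX^\theta)\,G^\theta_{\infty,b}(tY^\theta)\,dt .$$ -/

import Mathlib

open MeasureTheory Set Filter Topology

noncomputable section

namespace CauchyLaguerre

/-- The pairing `⟨P, Q⟩ = ∬_{ℝ₊²} e^{-(x+y)}/(x+y) x^a y^b P(x^θ) Q(y^θ) dx dy`. -/
def pairing (a b θ : ℝ) (P Q : Polynomial ℝ) : ℝ :=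
  ∫ p in Ioi (0 : ℝ) ×ˢ Ioi (0 : ℝ),
    Real.exp (-(p.1 + p.2)) / (p.1 + p.2) * p.1 ^ a * p.2 ^ b *
      P.eval (p.1 ^ θ) * Q.eval (p.2 ^ θ)

/-- The normalisation `h_n = θ / (2 n θ + a + b + 1)`. -/
def h (a b θ : ℝ) (n : ℕ) : ℝ := θ / (2 * n * θ + a + b + 1)

/-- `(P n), (Q n)` are `θ`-deformed Cauchy bi-orthogonal polynomials with Laguerre weight:
`P n` and `Q n` have degree `n` and `⟨P n, Q m⟩ = (h_n / θ) δ_{n,m}`. -/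
structure IsBiorthogonal (a b θ : ℝ) (P Q : ℕ → Polynomial ℝ) : Prop where
  degree_left : ∀ n, (P n).degree = n
  degree_right : ∀ n, (Q n).degree = n
  biorthogonal : ∀ n m, pairing a b θ (P n) (Q m) = if n = m then h a b θ n / θ else 0

/-- The Christoffel–Darboux kernel `K_N(x,y) = ∑_{n<N} (θ/h_n) P_n(x^θ) Q_n(y^θ)`. -/
def cdKernel (a b θ : ℝ) (P Q : ℕ → Polynomial ℝ) (N : ℕ) (x y : ℝ) : ℝ :=
  ∑ n ∈ Finset.range N,
    θ / h a b θ n * (P n).eval (x ^ θ) * (Q n).eval (y ^ θ)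

/-- The parameter `α = (a+b+1)/θ - 1`. -/
def alpha (a b θ : ℝ) : ℝ := (a + b + 1) / θ - 1

/-- A left loop: the path `-∞ + i·lower → right + i·lower → right + i·upper → -∞ + i·upper`,
which runs once, counterclockwise, around the half strip to its left. -/
structure LeftLoop where
  right : ℝ
  lower : ℝ
  upper : ℝ
  lower_lt_upper : lower < upper

namespace LeftLoop

/-- The point `s` lies strictly inside the loop. -/
def Encloses (γ : LeftLoop) (s : ℂ) : Prop :=
  s.re < γ.right ∧ γ.lower < s.im ∧ s.im < γ.upper

/-- The point `s` lies strictly outside the loop. -/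
def Excludes (γ : LeftLoop) (s : ℂ) : Prop :=
  γ.right < s.re ∨ s.im < γ.lower ∨ γ.upper < s.im

/-- `f` is absolutely integrable along the loop. -/
def Integrable (γ : LeftLoop) (f : ℂ → ℂ) : Prop :=
  IntegrableOn (fun x : ℝ => f (x + γ.lower * Complex.I)) (Iic γ.right) ∧
  IntervalIntegrable (fun y : ℝ => f (γ.right + y * Complex.I)) volume γ.lower γ.upper ∧
  IntegrableOn (fun x : ℝ => f (x + γ.upper * Complex.I)) (Iic γ.right)

/-- The contour integral `∫_γ f(u) du / (2πi)`. -/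
def integral (γ : LeftLoop) (f : ℂ → ℂ) : ℂ :=
  (2 * Real.pi * Complex.I)⁻¹ *
    ((∫ x in Iic γ.right, f (x + γ.lower * Complex.I)) +
      Complex.I * (∫ y in γ.lower..γ.upper, f (γ.right + y * Complex.I)) -
      ∫ x in Iic γ.right, f (x + γ.upper * Complex.I))

end LeftLoop

/-- The Mellin–Barnes integrand
`∏_{j≤m} Γ(b_j+B_j s) ∏_{j≤n} Γ(1-a_j-A_j s) /
  (∏_{j>m} Γ(1-b_j-B_j s) ∏_{j>n} Γ(a_j+A_j s)) · z^{-s}`.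
At a pole of a denominator factor the quotient takes its correct value `0`. -/
def foxIntegrand {p q : ℕ} (m n : ℕ) (a : Fin p → ℂ) (A : Fin p → ℝ)
    (b : Fin q → ℂ) (B : Fin q → ℝ) (z s : ℂ) : ℂ :=
  (∏ j : Fin q with j.val < m, Complex.Gamma (b j + B j * s)) *
      (∏ j : Fin p with j.val < n, Complex.Gamma (1 - a j - A j * s)) /
    ((∏ j : Fin q with m ≤ j.val, Complex.Gamma (1 - b j - B j * s)) *
      (∏ j : Fin p with n ≤ j.val, Complex.Gamma (a j + A j * s))) * z ^ (-s)

/-- The left loop `γ` is suitable for the Fox H-function: it encloses all poles of the factors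
`Γ(b_j+B_j s)`, `j ≤ m`, excludes all poles of the factors `Γ(1-a_j-A_j s)`, `j ≤ n`, and the
Mellin–Barnes integral converges absolutely along it. -/
def FoxSuitable {p q : ℕ} (m n : ℕ) (a : Fin p → ℂ) (A : Fin p → ℝ)
    (b : Fin q → ℂ) (B : Fin q → ℝ) (z : ℂ) (γ : LeftLoop) : Prop :=
  (∀ j : Fin q, j.val < m → ∀ k : ℕ, γ.Encloses (-(b j + k) / B j)) ∧
  (∀ j : Fin p, j.val < n → ∀ k : ℕ, γ.Excludes ((1 - a j + k) / A j)) ∧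
  γ.Integrable (foxIntegrand m n a A b B z)

/-- The Fox H-function `H^{m,n}_{p,q}[z | (a_j,A_j); (b_j,B_j)]`, with contour the loop `γ`. -/
def foxH {p q : ℕ} (m n : ℕ) (a : Fin p → ℂ) (A : Fin p → ℝ)
    (b : Fin q → ℂ) (B : Fin q → ℝ) (γ : LeftLoop) (z : ℂ) : ℂ :=
  γ.integral (foxIntegrand m n a A b B z)

/-- The integrand `Γ(u) z^{-u} / (Γ(α-u+1) Γ(c-θu+1))`. -/
def gIntegrand (θ α c : ℝ) (z u : ℂ) : ℂ :=
  Complex.Gamma u * z ^ (-u) / (Complex.Gamma (α - u + 1) * Complex.Gamma (c - θ * u + 1))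

/-- `G^θ_{∞,c}(z) = ∫_γ du/(2πi) Γ(u) z^{-u} / (Γ(α-u+1) Γ(c-θu+1))`. -/
def gInf (γ : LeftLoop) (θ α c : ℝ) (z : ℂ) : ℂ :=
  γ.integral (gIntegrand θ α c z)

end CauchyLaguerre

end

/-! Put `s = α + 1`. The pairing of `x ^ (iθ)` with `y ^ (jθ)`, divided by
`Γ(a + iθ + 1) Γ(b + jθ + 1)`, is `θ⁻¹ / (s + i + j)`, so in these monomials the Gram matrix is a
generalised Hilbert matrix. The coefficient matrix of the Christoffel–Darboux kernel is the inverse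
of the Gram matrix, whichever biorthogonal system is chosen. Jacobi polynomials, orthogonal on
`[0, 1]` for the weight `t ^ (s - 1)`, diagonalise the Hilbert matrix; a telescoping sum over their
coefficients then gives the entries `κ_k(N) κ_l(N) / (s + k + l)` of the inverse.

As `N → ∞`, `κ_k(N) / N ^ (s + 2k)` tends to `(-1) ^ k / (k! Γ(s + k))` and is dominated by a
geometric sequence over a factorial, so the rescaled kernel converges to a double series. Writing
`1 / (s + k + l) = ∫₀¹ t ^ (α + k + l) dt` turns that series into the integral of a product of two
series in `t`. Each of these is the residue expansion of `G`, obtained by pushing the vertical edge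
of the loop to `-∞` between the poles of `Γ`. -/

namespace CauchyLaguerre

section Moments

lemma lintegral_rpow_mul_exp_neg_mul_Ioi {p r : ℝ} (hp : -1 < p) (hr : 0 < r) :
    ∫⁻ t in Ioi (0 : ℝ), ENNReal.ofReal (t ^ p * Real.exp (-(r * t))) =
      ENNReal.ofReal (r ^ (-(p + 1)) * Real.Gamma (p + 1)) := by
  have hint : IntegrableOn (fun t : ℝ => t ^ p * Real.exp (-(r * t))) (Ioi 0) := by
    simpa using integrableOn_rpow_mul_exp_neg_mul_rpow hp one_pos hr
  have hI := Real.integral_rpow_mul_exp_neg_mul_Ioi (a := p + 1) (by linarith) hr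
  rw [add_sub_cancel_right] at hI
  rw [← ofReal_integral_eq_lintegral_ofReal hint, hI, one_div, Real.inv_rpow hr.le,
    Real.rpow_neg hr.le]
  filter_upwards [self_mem_ae_restrict measurableSet_Ioi] with t ht
  exact mul_nonneg (Real.rpow_nonneg (mem_Ioi.1 ht).le _) (Real.exp_nonneg _)

lemma lintegral_exp_neg_mul_Ioi_one {c : ℝ} (hc : 0 < c) :
    ∫⁻ t in Ioi (1 : ℝ), ENNReal.ofReal (Real.exp (-c * t)) =
      ENNReal.ofReal (Real.exp (-c) / c) := by
  rw [← ofReal_integral_eq_lintegral_ofReal (integrableOn_exp_mul_Ioi (by linarith) 1)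
    (Eventually.of_forall fun t => Real.exp_nonneg _), integral_exp_mul_Ioi (by linarith), mul_one,
    neg_div_neg_eq]

lemma lintegral_rpow_neg_Ioi_one {p : ℝ} (hp : 0 < p) :
    ∫⁻ t in Ioi (1 : ℝ), ENNReal.ofReal (t ^ (-(p + 1))) = ENNReal.ofReal p⁻¹ := by
  rw [← ofReal_integral_eq_lintegral_ofReal (integrableOn_Ioi_rpow_of_lt (by linarith) one_pos),
    integral_Ioi_rpow_of_lt (by linarith) one_pos, Real.one_rpow, neg_add, neg_add_cancel_right,
    neg_div_neg_eq, one_div]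
  filter_upwards [self_mem_ae_restrict measurableSet_Ioi] with t ht
  exact Real.rpow_nonneg (zero_le_one.trans (mem_Ioi.1 ht).le) _

/-- The weight `e^{-(x+y)}/(x+y) x^p y^q` of the Cauchy–Laguerre pairing. -/
noncomputable def cauchyWeight (p q : ℝ) (z : ℝ × ℝ) : ℝ :=
  Real.exp (-(z.1 + z.2)) / (z.1 + z.2) * z.1 ^ p * z.2 ^ q

lemma measurable_cauchyWeight (p q : ℝ) : Measurable (cauchyWeight p q) := by
  unfold cauchyWeight
  fun_prop

lemma cauchyWeight_nonneg {p q : ℝ} {z : ℝ × ℝ} (hz : z ∈ Ioi (0 : ℝ) ×ˢ Ioi (0 : ℝ)) :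
    0 ≤ cauchyWeight p q z := by
  obtain ⟨hx, hy⟩ := hz
  simp only [mem_Ioi] at hx hy
  unfold cauchyWeight
  positivity

lemma ae_cauchyWeight_nonneg (p q : ℝ) :
    0 ≤ᵐ[volume.restrict (Ioi (0 : ℝ) ×ˢ Ioi (0 : ℝ))] cauchyWeight p q := by
  filter_upwards [self_mem_ae_restrict (measurableSet_Ioi.prod measurableSet_Ioi)] with z hz
  exact cauchyWeight_nonneg hz

/-- The integrand `t^p e^{-rt}` of the Gamma integral, as an extended nonnegative real. -/
noncomputable def gammaDensity (p r t : ℝ) : ENNReal :=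
  ENNReal.ofReal (t ^ p * Real.exp (-(r * t)))

lemma measurable_gammaDensity (p : ℝ) : Measurable fun z : ℝ × ℝ => gammaDensity p z.1 z.2 := by
  unfold gammaDensity
  fun_prop

lemma ofReal_cauchyWeight_eq_lintegral (p q : ℝ) {x y : ℝ} (hx : 0 < x) (hy : 0 < y) :
    ENNReal.ofReal (cauchyWeight p q (x, y)) =
      ∫⁻ r in Ioi (1 : ℝ), gammaDensity p r x * gammaDensity q r y := by
  have hmul : ∀ r : ℝ, gammaDensity p r x * gammaDensity q r y =
      ENNReal.ofReal (x ^ p * y ^ q) * ENNReal.ofReal (Real.exp (-(x + y) * r)) := by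
    intro r
    rw [gammaDensity, gammaDensity, ← ENNReal.ofReal_mul (by positivity),
      ← ENNReal.ofReal_mul (by positivity), mul_mul_mul_comm, ← Real.exp_add]
    ring_nf
  simp only [hmul]
  rw [lintegral_const_mul _ (by fun_prop), lintegral_exp_neg_mul_Ioi_one (by linarith),
    ← ENNReal.ofReal_mul (by positivity)]
  simp only [cauchyWeight]
  ring_nf

lemma lintegral_gammaDensity_mul {p q r : ℝ} (hp : -1 < p) (hq : -1 < q) (hr : 0 < r) :
    ∫⁻ z in Ioi (0 : ℝ) ×ˢ Ioi (0 : ℝ), gammaDensity p r z.1 * gammaDensity q r z.2 =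
      ENNReal.ofReal (Real.Gamma (p + 1) * Real.Gamma (q + 1)) *
        ENNReal.ofReal (r ^ (-(p + q + 1 + 1))) := by
  have hΓ : 0 < Real.Gamma (p + 1) := Real.Gamma_pos_of_pos (by linarith)
  have hΓ' : 0 < Real.Gamma (q + 1) := Real.Gamma_pos_of_pos (by linarith)
  have hmeas : ∀ p, AEMeasurable (gammaDensity p r) (volume.restrict (Ioi 0)) := fun p =>
    ((measurable_gammaDensity p).comp measurable_prodMk_left).aemeasurable
  rw [Measure.volume_eq_prod, ← Measure.prod_restrict, lintegral_prod_mul (hmeas p) (hmeas q)]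
  simp only [gammaDensity]
  rw [lintegral_rpow_mul_exp_neg_mul_Ioi hp hr, lintegral_rpow_mul_exp_neg_mul_Ioi hq hr,
    ← ENNReal.ofReal_mul (by positivity), ← ENNReal.ofReal_mul (by positivity),
    show -(p + q + 1 + 1) = -(p + 1) + -(q + 1) by ring, Real.rpow_add hr]
  ring_nf

-- `e^{-c}/c` is the integral of `e^{-cr}` over `r > 1`, which decouples the two variables.
lemma lintegral_cauchyWeight {p q : ℝ} (hp : -1 < p) (hq : -1 < q) (hpq : 0 < p + q + 1) :
    ∫⁻ z in Ioi (0 : ℝ) ×ˢ Ioi (0 : ℝ), ENNReal.ofReal (cauchyWeight p q z) =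
      ENNReal.ofReal (Real.Gamma (p + 1) * Real.Gamma (q + 1) / (p + q + 1)) := by
  have hΓ : 0 < Real.Gamma (p + 1) := Real.Gamma_pos_of_pos (by linarith)
  have hΓ' : 0 < Real.Gamma (q + 1) := Real.Gamma_pos_of_pos (by linarith)
  have hmeas : Measurable fun w : (ℝ × ℝ) × ℝ =>
      gammaDensity p w.2 w.1.1 * gammaDensity q w.2 w.1.2 :=
    ((measurable_gammaDensity p).comp (measurable_snd.prodMk measurable_fst.fst)).mul
      ((measurable_gammaDensity q).comp (measurable_snd.prodMk measurable_fst.snd))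
  calc ∫⁻ z in Ioi (0 : ℝ) ×ˢ Ioi (0 : ℝ), ENNReal.ofReal (cauchyWeight p q z)
      = ∫⁻ z in Ioi (0 : ℝ) ×ˢ Ioi (0 : ℝ), ∫⁻ r in Ioi (1 : ℝ),
          gammaDensity p r z.1 * gammaDensity q r z.2 :=
        setLIntegral_congr_fun (measurableSet_Ioi.prod measurableSet_Ioi) fun z hz =>
          ofReal_cauchyWeight_eq_lintegral p q hz.1 hz.2
    _ = ∫⁻ r in Ioi (1 : ℝ), ∫⁻ z in Ioi (0 : ℝ) ×ˢ Ioi (0 : ℝ),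
          gammaDensity p r z.1 * gammaDensity q r z.2 :=
        lintegral_lintegral_swap hmeas.aemeasurable
    _ = ∫⁻ r in Ioi (1 : ℝ), ENNReal.ofReal (Real.Gamma (p + 1) * Real.Gamma (q + 1)) *
          ENNReal.ofReal (r ^ (-(p + q + 1 + 1))) :=
        setLIntegral_congr_fun measurableSet_Ioi fun r hr =>
          lintegral_gammaDensity_mul hp hq (zero_lt_one.trans hr)
    _ = ENNReal.ofReal (Real.Gamma (p + 1) * Real.Gamma (q + 1) / (p + q + 1)) := by
        rw [lintegral_const_mul _ (by fun_prop), lintegral_rpow_neg_Ioi_one hpq,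
          ← ENNReal.ofReal_mul (by positivity), div_eq_mul_inv]

lemma integrableOn_cauchyWeight {p q : ℝ} (hp : -1 < p) (hq : -1 < q) (hpq : 0 < p + q + 1) :
    IntegrableOn (cauchyWeight p q) (Ioi (0 : ℝ) ×ˢ Ioi (0 : ℝ)) := by
  refine ⟨(measurable_cauchyWeight p q).aestronglyMeasurable, ?_⟩
  rw [hasFiniteIntegral_iff_ofReal (ae_cauchyWeight_nonneg p q), lintegral_cauchyWeight hp hq hpq]
  exact ENNReal.ofReal_lt_top

lemma integral_cauchyWeight {p q : ℝ} (hp : -1 < p) (hq : -1 < q) (hpq : 0 < p + q + 1) :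
    ∫ z in Ioi (0 : ℝ) ×ˢ Ioi (0 : ℝ), cauchyWeight p q z =
      Real.Gamma (p + 1) * Real.Gamma (q + 1) / (p + q + 1) := by
  have hΓ : 0 < Real.Gamma (p + 1) := Real.Gamma_pos_of_pos (by linarith)
  have hΓ' : 0 < Real.Gamma (q + 1) := Real.Gamma_pos_of_pos (by linarith)
  rw [integral_eq_lintegral_of_nonneg_ae (ae_cauchyWeight_nonneg p q)
    (measurable_cauchyWeight p q).aestronglyMeasurable, lintegral_cauchyWeight hp hq hpq,
    ENNReal.toReal_ofReal (by positivity)]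

end Moments

section PartialFractions

lemma prod_range_erase_natCast_sub {R : Type*} [CommRing R] {n i : ℕ} (hi : i ≤ n) :
    ∏ j ∈ (Finset.range (n + 1)).erase i, ((j : R) - i) =
      (-1) ^ i * i.factorial * (n - i).factorial := by
  obtain ⟨m, rfl⟩ := Nat.exists_eq_add_of_le hi
  have hbelow : ∏ j ∈ Finset.range i, ((j : R) - i) = (-1) ^ i * i.factorial := by
    rw [← Finset.prod_range_reflect, ← Finset.prod_range_add_one_eq_factorial, Nat.cast_prod,
      ← Finset.card_range i, ← Finset.prod_const, Finset.card_range, ← Finset.prod_mul_distrib]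
    refine Finset.prod_congr rfl fun j hj => ?_
    have hj := Finset.mem_range.1 hj
    rw [Nat.sub_sub, Nat.cast_sub (by omega)]
    push_cast
    ring
  have habove : ∏ j ∈ Finset.range m, (((i + 1 + j : ℕ) : R) - i) = m.factorial := by
    rw [← Finset.prod_range_add_one_eq_factorial, Nat.cast_prod]
    refine Finset.prod_congr rfl fun j _ => ?_
    push_cast
    ring
  have hsplit : (Finset.range (i + m + 1)).erase i =
      Finset.range i ∪ (Finset.range m).map (addLeftEmbedding (i + 1)) := by
    ext j
    simp only [Finset.mem_erase, Finset.mem_union, Finset.mem_range, Finset.mem_map,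
      addLeftEmbedding_apply]
    constructor
    · intro h
      by_cases hj : j < i
      · exact .inl hj
      · exact .inr ⟨j - (i + 1), by omega, by omega⟩
    · rintro (h | ⟨k, hk, rfl⟩) <;> omega
  rw [hsplit, Finset.prod_union, hbelow, Finset.prod_map]
  · simp only [addLeftEmbedding_apply, habove, Nat.add_sub_cancel_left]
  · rw [Finset.disjoint_left]
    simp only [Finset.mem_range, Finset.mem_map, addLeftEmbedding_apply]
    rintro j hj ⟨k, -, rfl⟩
    omega

lemma nodalWeight_neg_natCast {K : Type*} [Field K] [CharZero K] {n i : ℕ} (hi : i ≤ n) :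
    Lagrange.nodalWeight (Finset.range (n + 1)) (fun j : ℕ => -(j : K)) i =
      (-1) ^ i * n.choose i / n.factorial := by
  have hfact := congrArg (Nat.cast (R := K)) (Nat.choose_mul_factorial_mul_factorial hi)
  push_cast at hfact
  have hsign : ((-1 : K) ^ i) * (-1) ^ i = 1 := by rw [← mul_pow]; simp
  simp only [Lagrange.nodalWeight, Finset.prod_inv_distrib, neg_sub_neg]
  rw [prod_range_erase_natCast_sub hi, inv_eq_iff_eq_inv, inv_div]
  refine eq_div_of_mul_eq (mul_ne_zero (by simp) (Nat.cast_ne_zero.2 (Nat.choose_pos hi).ne')) ?_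
  linear_combination (-1 : K) ^ i * (-1) ^ i * hfact + (n.factorial : K) * hsign

/-- Partial fractions, from Lagrange interpolation of `p` at the nodes `0, -1, …, -n`. -/
lemma sum_alternating_choose_mul_eval_div {K : Type*} [Field K] [CharZero K] {n : ℕ}
    {p : Polynomial K} (hp : p.degree < ↑(n + 1)) {x : K} (hx : ∀ i : ℕ, x + i ≠ 0) :
    ∑ i ∈ Finset.range (n + 1), (-1) ^ i * n.choose i * p.eval (-(i : K)) / (x + i) =
      n.factorial * p.eval x / ∏ i ∈ Finset.range (n + 1), (x + i) := by
  have hinj : Set.InjOn (fun j : ℕ => -(j : K)) (Finset.range (n + 1)) := fun i _ j _ hij => by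
    simpa using hij
  have hinterp := Lagrange.eq_interpolate hinj (by simpa using hp)
  have heval := congrArg (Polynomial.eval x) hinterp
  rw [Lagrange.eval_interpolate_not_at_node _ fun i _ h => hx i (by simp [h]),
    Lagrange.eval_nodal] at heval
  simp only [sub_neg_eq_add] at heval
  have hn : (n.factorial : K) ≠ 0 := Nat.cast_ne_zero.2 n.factorial_ne_zero
  have hprod : ∏ i ∈ Finset.range (n + 1), (x + i) ≠ 0 := Finset.prod_ne_zero_iff.2 fun i _ => hx i
  rw [heval, mul_left_comm, mul_div_cancel_left₀ _ hprod, Finset.mul_sum]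
  refine Finset.sum_congr rfl fun i hi => ?_
  rw [nodalWeight_neg_natCast (Nat.lt_succ_iff.1 (Finset.mem_range.1 hi))]
  field_simp

end PartialFractions

section Jacobi

/-- The coefficient of `t^k` in the Jacobi polynomial of degree `n` on `[0, 1]` for the weight
`t^(s-1)`, normalised to take the value `(s)ₙ / n!` at `0`. -/
noncomputable def jacobiCoeff (s : ℝ) (n k : ℕ) : ℝ :=
  (-1) ^ k * n.choose k * (ascPochhammer ℝ n).eval (s + k) / n.factorial

lemma jacobiCoeff_eq_zero_of_lt (s : ℝ) {n k : ℕ} (hnk : n < k) : jacobiCoeff s n k = 0 := by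
  simp [jacobiCoeff, Nat.choose_eq_zero_of_lt hnk]

lemma jacobiCoeff_self_ne_zero {s : ℝ} (hs : 0 < s) (n : ℕ) : jacobiCoeff s n n ≠ 0 := by
  have hasc := ascPochhammer_pos n (s + n) (by positivity)
  simp [jacobiCoeff, hasc.ne', n.factorial_ne_zero]

lemma prod_range_add_natCast_eq_eval_ascPochhammer {R : Type*} [CommSemiring R] (n : ℕ) (x : R) :
    ∏ i ∈ Finset.range n, (x + i) = (ascPochhammer R n).eval x := by
  induction n with
  | zero => simp
  | succ n ih => rw [Finset.prod_range_succ, ascPochhammer_succ_eval, ih]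

lemma sum_jacobiCoeff_div {s : ℝ} (hs : 0 < s) {n N : ℕ} (hn : n < N) (m : ℕ) :
    ∑ i ∈ Finset.range N, jacobiCoeff s n i / (s + i + m) =
      (ascPochhammer ℝ n).eval (-(m : ℝ)) / (ascPochhammer ℝ (n + 1)).eval (s + m) := by
  let p : Polynomial ℝ := (ascPochhammer ℝ n).comp (Polynomial.C s - Polynomial.X)
  have hdeg : p.degree < ↑(n + 1) := by
    refine Polynomial.degree_le_natDegree.trans_lt (Nat.cast_lt.2 (Nat.lt_succ_iff.2 ?_))
    refine Polynomial.natDegree_comp_le.trans ?_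
    rw [ascPochhammer_natDegree]
    exact mul_le_of_le_one_right' (Polynomial.natDegree_sub_le_of_le
      (Polynomial.natDegree_C _ |>.trans_le zero_le_one) Polynomial.natDegree_X_le)
  have hpartial := sum_alternating_choose_mul_eval_div hdeg (x := s + m) fun i => by positivity
  rw [prod_range_add_natCast_eq_eval_ascPochhammer] at hpartial
  have hn0 : (n.factorial : ℝ) ≠ 0 := by positivity
  rw [← Finset.sum_subset (Finset.range_mono (Nat.succ_le_of_lt hn)) fun i _ hi => by
    rw [jacobiCoeff_eq_zero_of_lt s (by simpa using hi), zero_div]]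
  calc ∑ i ∈ Finset.range (n + 1), jacobiCoeff s n i / (s + i + m)
      = (∑ i ∈ Finset.range (n + 1),
          (-1) ^ i * n.choose i * p.eval (-(i : ℝ)) / (s + m + i)) / n.factorial := by
        rw [Finset.sum_div]
        refine Finset.sum_congr rfl fun i _ => ?_
        simp only [jacobiCoeff, p, Polynomial.eval_comp, Polynomial.eval_sub, Polynomial.eval_C,
          Polynomial.eval_X, sub_neg_eq_add, add_right_comm s (m : ℝ)]
        ring
    _ = _ := by
        rw [hpartial]
        simp only [p, Polynomial.eval_comp, Polynomial.eval_sub, Polynomial.eval_C,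
          Polynomial.eval_X, sub_add_cancel_left]
        field_simp

/-- The generalised Hilbert matrix `(1 / (s + i + j))`, the Gram matrix of the monomials in
`L²([0, 1], t^(s-1) dt)`. -/
noncomputable def hilbertMatrix (s : ℝ) (N : ℕ) : Matrix (Fin N) (Fin N) ℝ :=
  Matrix.of fun i j => (s + i + j)⁻¹

/-- The lower triangular matrix whose rows are the coefficients of the Jacobi polynomials. -/
noncomputable def jacobiMatrix (s : ℝ) (N : ℕ) : Matrix (Fin N) (Fin N) ℝ :=
  Matrix.of fun n k => jacobiCoeff s n k

lemma jacobiMatrix_mul_hilbertMatrix_apply {s : ℝ} (hs : 0 < s) {N : ℕ} (n m : Fin N) :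
    (jacobiMatrix s N * hilbertMatrix s N) n m =
      (ascPochhammer ℝ n).eval (-(m : ℝ)) / (ascPochhammer ℝ (n + 1)).eval (s + m) := by
  rw [← sum_jacobiCoeff_div hs n.isLt, ← Fin.sum_univ_eq_sum_range fun i =>
    jacobiCoeff s n i / (s + i + m)]
  simp [Matrix.mul_apply, jacobiMatrix, hilbertMatrix, div_eq_mul_inv]

lemma jacobiMatrix_mul_hilbertMatrix_apply_of_lt {s : ℝ} (hs : 0 < s) {N : ℕ} {n m : Fin N}
    (hmn : m < n) : (jacobiMatrix s N * hilbertMatrix s N) n m = 0 := by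
  rw [jacobiMatrix_mul_hilbertMatrix_apply hs, ascPochhammer_eval_neg_coe_nat_of_lt hmn, zero_div]

lemma jacobiMatrix_mul_hilbertMatrix_apply_self_mul {s : ℝ} (hs : 0 < s) {N : ℕ} (n : Fin N) :
    (jacobiMatrix s N * hilbertMatrix s N) n n * jacobiCoeff s n n = (2 * n + s)⁻¹ := by
  have hasc := (ascPochhammer_pos n (s + (n : ℕ)) (by positivity)).ne'
  have hsn : s + (n : ℕ) + (n : ℕ) ≠ 0 := by positivity
  have : 2 * ((n : ℕ) : ℝ) + s ≠ 0 := by positivity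
  have hsign : ((-1 : ℝ) ^ (n : ℕ)) * (-1) ^ (n : ℕ) = 1 := by rw [← mul_pow]; simp
  rw [jacobiMatrix_mul_hilbertMatrix_apply hs, ascPochhammer_eval_neg_eq_descPochhammer,
    descPochhammer_eval_eq_descFactorial, Nat.descFactorial_self, ascPochhammer_succ_eval,
    jacobiCoeff, Nat.choose_self]
  field_simp
  push_cast
  linear_combination (2 * ((n : ℕ) : ℝ) + s) * hsign

lemma isSymm_hilbertMatrix (s : ℝ) (N : ℕ) : (hilbertMatrix s N).IsSymm := by
  ext i j
  simp [hilbertMatrix, add_right_comm]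

open Matrix in
lemma jacobiMatrix_mul_hilbertMatrix_mul_transpose {s : ℝ} (hs : 0 < s) (N : ℕ) :
    jacobiMatrix s N * hilbertMatrix s N * (jacobiMatrix s N)ᵀ =
      diagonal fun n : Fin N => (2 * (n : ℝ) + s)⁻¹ := by
  have hlower : ∀ n m : Fin N, m ≤ n →
      (jacobiMatrix s N * hilbertMatrix s N * (jacobiMatrix s N)ᵀ) n m =
        diagonal (fun n : Fin N => (2 * (n : ℝ) + s)⁻¹) n m := by
    intro n m hmn
    rw [Matrix.mul_apply, Finset.sum_eq_single n]
    · rcases hmn.lt_or_eq with hmn | rfl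
      · simp [jacobiMatrix, jacobiCoeff_eq_zero_of_lt s hmn, hmn.ne']
      · simpa [jacobiMatrix] using jacobiMatrix_mul_hilbertMatrix_apply_self_mul hs m
    · intro j _ hj
      rcases lt_or_gt_of_ne hj with hj | hj
      · rw [jacobiMatrix_mul_hilbertMatrix_apply_of_lt hs hj, zero_mul]
      · simp [jacobiMatrix, jacobiCoeff_eq_zero_of_lt s (hmn.trans_lt hj)]
    · exact fun h => absurd (Finset.mem_univ n) h
  have hsymm : (jacobiMatrix s N * hilbertMatrix s N * (jacobiMatrix s N)ᵀ).IsSymm := by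
    rw [Matrix.IsSymm, transpose_mul, transpose_mul, transpose_transpose,
      (isSymm_hilbertMatrix s N).eq, Matrix.mul_assoc]
  ext n m
  rcases le_total m n with hmn | hnm
  · exact hlower n m hmn
  · rw [← hsymm.apply, hlower m n hnm, (isSymm_diagonal _).apply]

lemma inv_eq_mul_mul_of_mul_mul_mul_eq_one {ι R : Type*} [Fintype ι] [DecidableEq ι] [CommRing R]
    {A G B E : Matrix ι ι R} (hAGBE : A * G * B * E = 1) : G⁻¹ = B * E * A := by
  refine Matrix.inv_eq_right_inv ?_
  rw [← mul_assoc, mul_eq_one_comm, ← hAGBE]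
  simp only [mul_assoc]

/-- The factor `κ_k(N)` in the entries `κ_k(N) κ_l(N) / (s + k + l)` of the inverse of the
generalised Hilbert matrix of size `N`. -/
noncomputable def kernelFactor (s : ℝ) (N k : ℕ) : ℝ :=
  (N - k) * jacobiCoeff s N k

lemma kernelFactor_zero (s : ℝ) (k : ℕ) : kernelFactor s 0 k = 0 := by
  cases k <;> simp [kernelFactor, jacobiCoeff]

lemma kernelFactor_succ (s : ℝ) (n k : ℕ) :
    kernelFactor s (n + 1) k = (s + n + k) * jacobiCoeff s n k := by
  have hchoose : ((n + 1 : ℕ) - k : ℝ) * (n + 1).choose k = (n + 1) * n.choose k := by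
    rcases le_or_gt k (n + 1) with hk | hk
    · have h := congrArg (Nat.cast (R := ℝ)) (Nat.choose_mul_succ_eq n k)
      push_cast [Nat.cast_sub hk] at h ⊢
      linear_combination -h
    · simp [Nat.choose_eq_zero_of_lt hk, Nat.choose_eq_zero_of_lt (Nat.lt_of_succ_lt hk)]
  rw [kernelFactor, jacobiCoeff, jacobiCoeff, ascPochhammer_succ_eval, Nat.factorial_succ]
  push_cast at hchoose ⊢
  rw [div_eq_mul_inv, div_eq_mul_inv, mul_inv]
  have hn' : (n + 1 : ℝ) * (n + 1 : ℝ)⁻¹ = 1 := mul_inv_cancel₀ (by positivity)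
  linear_combination (-1) ^ k * (ascPochhammer ℝ n).eval (s + k) * (s + k + n) *
    ((n + 1 : ℝ)⁻¹ * (n.factorial : ℝ)⁻¹ * hchoose + n.choose k * (n.factorial : ℝ)⁻¹ * hn')

/-- A Christoffel–Darboux formula: the sum telescopes. -/
lemma sum_mul_jacobiCoeff_mul_jacobiCoeff {s : ℝ} (hs : 0 < s) (N k l : ℕ) :
    ∑ n ∈ Finset.range N, (2 * n + s) * jacobiCoeff s n k * jacobiCoeff s n l =
      kernelFactor s N k * kernelFactor s N l / (s + k + l) := by
  rw [eq_div_iff (by positivity), Finset.sum_mul]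
  refine Finset.sum_range_induction _ (fun n => kernelFactor s n k * kernelFactor s n l)
    (by simp [kernelFactor_zero]) N fun n _ => ?_
  rw [kernelFactor_succ, kernelFactor_succ, kernelFactor, kernelFactor]
  ring

open Matrix in
lemma inv_hilbertMatrix_apply {s : ℝ} (hs : 0 < s) {N : ℕ} (k l : Fin N) :
    (hilbertMatrix s N)⁻¹ k l = kernelFactor s N k * kernelFactor s N l / (s + k + l) := by
  have hinv : (diagonal fun n : Fin N => (2 * (n : ℝ) + s)⁻¹) *
      diagonal (fun n : Fin N => 2 * (n : ℝ) + s) = 1 := by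
    rw [diagonal_mul_diagonal, ← diagonal_one]
    congr 1
    ext n
    exact inv_mul_cancel₀ (by positivity)
  rw [← jacobiMatrix_mul_hilbertMatrix_mul_transpose hs] at hinv
  rw [inv_eq_mul_mul_of_mul_mul_mul_eq_one hinv, Matrix.mul_apply,
    ← sum_mul_jacobiCoeff_mul_jacobiCoeff hs, ← Fin.sum_univ_eq_sum_range fun n =>
      (2 * (n : ℝ) + s) * jacobiCoeff s n k * jacobiCoeff s n l]
  simp [jacobiMatrix, mul_comm]

end Jacobi

section Biorthogonal

lemma alpha_add_one_pos {a b θ : ℝ} (hθ : 0 < θ) (hab : 0 < a + b + 1) : 0 < alpha a b θ + 1 := by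
  rw [alpha, sub_add_cancel]
  positivity

lemma mul_alpha_add_one {a b θ : ℝ} (hθ : θ ≠ 0) : θ * (alpha a b θ + 1) = a + b + 1 := by
  rw [alpha, sub_add_cancel, mul_div_cancel₀ _ hθ]

lemma h_eq_inv {a b θ : ℝ} (hθ : θ ≠ 0) (n : ℕ) :
    h a b θ n = (2 * n + (alpha a b θ + 1))⁻¹ := by
  have hden : 2 * n * θ + a + b + 1 = θ * (2 * n + (alpha a b θ + 1)) := by
    rw [mul_add, mul_alpha_add_one hθ]
    ring
  rw [h, hden, div_mul_cancel_left₀ hθ]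

lemma Gamma_add_natCast_mul_pos {a θ : ℝ} (hθ : 0 < θ) (ha : -1 < a) (i : ℕ) :
    0 < Real.Gamma (a + i * θ + 1) :=
  Real.Gamma_pos_of_pos (by nlinarith [mul_nonneg i.cast_nonneg hθ.le])

/-- The coefficient of `P(x^θ)` along the normalised monomial `x^{iθ} / Γ(a+iθ+1)`. -/
noncomputable def gammaCoeff (a θ : ℝ) (P : Polynomial ℝ) (i : ℕ) : ℝ :=
  P.coeff i * Real.Gamma (a + i * θ + 1)

/-- The normalised monomial `x^{iθ} / Γ(a+iθ+1)`. -/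
noncomputable def gammaMonomial (a θ x : ℝ) (i : ℕ) : ℝ :=
  (x ^ θ) ^ i / Real.Gamma (a + i * θ + 1)

lemma eval_rpow_eq_sum_gammaCoeff {a θ : ℝ} (hθ : 0 < θ) (ha : -1 < a) {P : Polynomial ℝ} {N : ℕ}
    (hP : P.natDegree < N) (x : ℝ) :
    P.eval (x ^ θ) = ∑ i : Fin N, gammaCoeff a θ P i * gammaMonomial a θ x i := by
  rw [Polynomial.eval_eq_sum_range' hP, ← Fin.sum_univ_eq_sum_range fun i =>
    P.coeff i * (x ^ θ) ^ i]
  refine Finset.sum_congr rfl fun i _ => ?_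
  have hΓ := (Gamma_add_natCast_mul_pos hθ ha i).ne'
  rw [gammaCoeff, gammaMonomial]
  field_simp

lemma integrand_pairing_eq_sum (a b θ : ℝ) {P Q : Polynomial ℝ} {N : ℕ} (hP : P.natDegree < N)
    (hQ : Q.natDegree < N) {z : ℝ × ℝ} (hz : z ∈ Ioi (0 : ℝ) ×ˢ Ioi (0 : ℝ)) :
    Real.exp (-(z.1 + z.2)) / (z.1 + z.2) * z.1 ^ a * z.2 ^ b * P.eval (z.1 ^ θ) *
        Q.eval (z.2 ^ θ) =
      ∑ i : Fin N, ∑ j : Fin N,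
        P.coeff i * Q.coeff j * cauchyWeight (a + (i : ℕ) * θ) (b + (j : ℕ) * θ) z := by
  have hrpow : ∀ {x : ℝ}, 0 < x → ∀ (c : ℝ) (i : ℕ), x ^ (c + i * θ) = x ^ c * (x ^ θ) ^ i :=
    fun hx c i => by rw [Real.rpow_add hx, mul_comm (i : ℝ), Real.rpow_mul_natCast hx.le]
  rw [Polynomial.eval_eq_sum_range' hP, Polynomial.eval_eq_sum_range' hQ, mul_assoc,
    ← Fin.sum_univ_eq_sum_range fun i => P.coeff i * (z.1 ^ θ) ^ i,
    ← Fin.sum_univ_eq_sum_range fun i => Q.coeff i * (z.2 ^ θ) ^ i, Finset.sum_mul_sum,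
    Finset.mul_sum]
  refine Finset.sum_congr rfl fun i _ => ?_
  rw [Finset.mul_sum]
  refine Finset.sum_congr rfl fun j _ => ?_
  rw [cauchyWeight, hrpow hz.1, hrpow hz.2]
  ring

open Matrix in
lemma pairing_eq_dotProduct {a b θ : ℝ} (hθ : 0 < θ) (ha : -1 < a) (hb : -1 < b)
    (hab : 0 < a + b + 1) {P Q : Polynomial ℝ} {N : ℕ} (hP : P.natDegree < N)
    (hQ : Q.natDegree < N) :
    pairing a b θ P Q = θ⁻¹ * ((fun i : Fin N => gammaCoeff a θ P i) ⬝ᵥ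
      hilbertMatrix (alpha a b θ + 1) N *ᵥ fun j : Fin N => gammaCoeff b θ Q j) := by
  have hnn : ∀ i : ℕ, 0 ≤ (i : ℝ) * θ := fun i => by positivity
  have hint : ∀ i j : Fin N, Integrable
      (fun z => P.coeff i * Q.coeff j * cauchyWeight (a + (i : ℕ) * θ) (b + (j : ℕ) * θ) z)
      (volume.restrict (Ioi (0 : ℝ) ×ˢ Ioi (0 : ℝ))) := fun i j =>
    (integrableOn_cauchyWeight (by linarith [hnn i]) (by linarith [hnn j])
      (by linarith [hnn i, hnn j])).const_mul _
  rw [pairing, setIntegral_congr_fun (measurableSet_Ioi.prod measurableSet_Ioi) fun z hz =>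
    integrand_pairing_eq_sum a b θ hP hQ hz, integral_finsetSum _ fun i _ =>
      integrable_finsetSum _ fun j _ => hint i j, dotProduct, Finset.mul_sum]
  refine Finset.sum_congr rfl fun i _ => ?_
  rw [integral_finsetSum _ fun j _ => hint i j, mulVec, dotProduct, Finset.mul_sum,
    Finset.mul_sum]
  refine Finset.sum_congr rfl fun j _ => ?_
  have hden : a + (i : ℕ) * θ + (b + (j : ℕ) * θ) + 1 =
      θ * (alpha a b θ + 1 + (i : ℕ) + (j : ℕ)) := by
    linear_combination -mul_alpha_add_one (a := a) (b := b) hθ.ne'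
  rw [integral_const_mul, integral_cauchyWeight (by linarith [hnn i]) (by linarith [hnn j])
    (by linarith [hnn i, hnn j]), hden, hilbertMatrix, Matrix.of_apply, gammaCoeff, gammaCoeff,
    div_eq_mul_inv, mul_inv]
  ring

/-- The matrix of coefficients of the first `N` polynomials `P n` along the normalised
monomials. -/
noncomputable def gammaMatrix (a θ : ℝ) (P : ℕ → Polynomial ℝ) (N : ℕ) :
    Matrix (Fin N) (Fin N) ℝ :=
  Matrix.of fun n i => gammaCoeff a θ (P n) i

lemma gammaMatrix_mulVec_gammaMonomial {a θ : ℝ} (hθ : 0 < θ) (ha : -1 < a)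
    {P : ℕ → Polynomial ℝ} (hP : ∀ n, (P n).degree = n) (x : ℝ) {N : ℕ} (n : Fin N) :
    (gammaMatrix a θ P N).mulVec (fun i => gammaMonomial a θ x i) n = (P n).eval (x ^ θ) := by
  rw [eval_rpow_eq_sum_gammaCoeff hθ ha
    ((Polynomial.natDegree_eq_of_degree_eq_some (hP n)).trans_lt n.isLt)]
  rfl

section

variable {a b θ : ℝ} {P Q : ℕ → Polynomial ℝ}

open Matrix in
lemma IsBiorthogonal.gammaMatrix_mul_hilbertMatrix_mul_transpose
    (hPQ : IsBiorthogonal a b θ P Q) (hθ : 0 < θ) (ha : -1 < a) (hb : -1 < b)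
    (hab : 0 < a + b + 1) (N : ℕ) :
    gammaMatrix a θ P N * hilbertMatrix (alpha a b θ + 1) N * (gammaMatrix b θ Q N)ᵀ =
      diagonal fun n : Fin N => h a b θ n := by
  ext n m
  have hP := (Polynomial.natDegree_eq_of_degree_eq_some (hPQ.degree_left n)).trans_lt n.isLt
  have hQ := (Polynomial.natDegree_eq_of_degree_eq_some (hPQ.degree_right m)).trans_lt m.isLt
  have hpair := hPQ.biorthogonal n m
  rw [pairing_eq_dotProduct hθ ha hb hab hP hQ, inv_mul_eq_iff_eq_mul₀ hθ.ne', mul_ite, mul_zero,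
    mul_div_cancel₀ _ hθ.ne'] at hpair
  simp only [Matrix.mul_assoc, diagonal_apply, Fin.ext_iff]
  exact hpair

open Matrix in
-- The coefficient matrix of the kernel is the inverse Gram matrix, so it does not depend on the
-- choice of the biorthogonal system.
lemma IsBiorthogonal.cdKernel_eq_dotProduct (hPQ : IsBiorthogonal a b θ P Q) (hθ : 0 < θ)
    (ha : -1 < a) (hb : -1 < b) (hab : 0 < a + b + 1) (N : ℕ) (x y : ℝ) :
    cdKernel a b θ P Q N x y = θ * ((fun l : Fin N => gammaMonomial b θ y l) ⬝ᵥ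
      (hilbertMatrix (alpha a b θ + 1) N)⁻¹ *ᵥ fun k : Fin N => gammaMonomial a θ x k) := by
  have hone : (diagonal fun n : Fin N => h a b θ n) * diagonal (fun n : Fin N => (h a b θ n)⁻¹) =
      1 := by
    rw [diagonal_mul_diagonal, ← diagonal_one]
    congr 1
    ext n
    refine mul_inv_cancel₀ ?_
    have hs := alpha_add_one_pos hθ hab
    rw [h_eq_inv hθ.ne']
    positivity
  rw [← hPQ.gammaMatrix_mul_hilbertMatrix_mul_transpose hθ ha hb hab] at hone
  rw [inv_eq_mul_mul_of_mul_mul_mul_eq_one hone, ← mulVec_mulVec, ← mulVec_mulVec,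
    dotProduct_mulVec, vecMul_transpose, cdKernel, dotProduct, Finset.mul_sum,
    ← Fin.sum_univ_eq_sum_range fun n =>
      θ / h a b θ n * (P n).eval (x ^ θ) * (Q n).eval (y ^ θ)]
  refine Finset.sum_congr rfl fun n _ => ?_
  rw [mulVec_diagonal, gammaMatrix_mulVec_gammaMonomial hθ ha hPQ.degree_left,
    gammaMatrix_mulVec_gammaMonomial hθ hb hPQ.degree_right]
  ring

lemma IsBiorthogonal.cdKernel_eq_sum (hPQ : IsBiorthogonal a b θ P Q) (hθ : 0 < θ)
    (ha : -1 < a) (hb : -1 < b) (hab : 0 < a + b + 1) (N : ℕ) (x y : ℝ) :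
    cdKernel a b θ P Q N x y = θ * ∑ k ∈ Finset.range N, ∑ l ∈ Finset.range N,
      kernelFactor (alpha a b θ + 1) N k * gammaMonomial a θ x k *
        (kernelFactor (alpha a b θ + 1) N l * gammaMonomial b θ y l) /
          (alpha a b θ + 1 + k + l) := by
  rw [hPQ.cdKernel_eq_dotProduct hθ ha hb hab, Finset.sum_comm, ← Fin.sum_univ_eq_sum_range
    fun l => ∑ k ∈ Finset.range N, _]
  congr 1
  refine Finset.sum_congr rfl fun l _ => ?_
  rw [Matrix.mulVec, dotProduct, Finset.mul_sum, ← Fin.sum_univ_eq_sum_range fun k =>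
    kernelFactor (alpha a b θ + 1) N k * gammaMonomial a θ x k *
      (kernelFactor (alpha a b θ + 1) N l * gammaMonomial b θ y l) / (alpha a b θ + 1 + k + l)]
  refine Finset.sum_congr rfl fun k _ => ?_
  rw [inv_hilbertMatrix_apply (alpha_add_one_pos hθ hab), add_right_comm]
  ring

end

/-- The polynomial with coefficient `J k / Γ(a+kθ+1)` at `X^k`, where `J k` are the coefficients of
the Jacobi polynomial of degree `n`. -/
noncomputable def jacobiTransform (a θ s : ℝ) (n : ℕ) : Polynomial ℝ :=
  ∑ k ∈ Finset.range (n + 1),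
    Polynomial.monomial k (jacobiCoeff s n k / Real.Gamma (a + k * θ + 1))

lemma coeff_jacobiTransform (a θ s : ℝ) (n k : ℕ) :
    (jacobiTransform a θ s n).coeff k = jacobiCoeff s n k / Real.Gamma (a + k * θ + 1) := by
  simp only [jacobiTransform, Polynomial.finsetSum_coeff, Polynomial.coeff_monomial,
    Finset.sum_ite_eq', Finset.mem_range, ite_eq_left_iff, not_lt]
  intro hk
  rw [jacobiCoeff_eq_zero_of_lt s hk, zero_div]

lemma degree_jacobiTransform {a θ s : ℝ} (hθ : 0 < θ) (ha : -1 < a) (hs : 0 < s) (n : ℕ) :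
    (jacobiTransform a θ s n).degree = n := by
  refine Polynomial.degree_eq_of_le_of_coeff_ne_zero ?_ ?_
  · rw [Polynomial.degree_le_iff_coeff_zero]
    intro k hk
    rw [coeff_jacobiTransform, jacobiCoeff_eq_zero_of_lt s (by exact_mod_cast hk), zero_div]
  · rw [coeff_jacobiTransform]
    exact div_ne_zero (jacobiCoeff_self_ne_zero hs n) (Gamma_add_natCast_mul_pos hθ ha n).ne'

lemma gammaCoeff_jacobiTransform {a θ : ℝ} (hθ : 0 < θ) (ha : -1 < a) (s : ℝ) (n k : ℕ) :
    gammaCoeff a θ (jacobiTransform a θ s n) k = jacobiCoeff s n k := by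
  rw [gammaCoeff, coeff_jacobiTransform, div_mul_cancel₀ _ (Gamma_add_natCast_mul_pos hθ ha k).ne']

lemma isBiorthogonal_jacobiTransform {a b θ : ℝ} (hθ : 0 < θ) (ha : -1 < a) (hb : -1 < b)
    (hab : 0 < a + b + 1) :
    IsBiorthogonal a b θ (jacobiTransform a θ (alpha a b θ + 1))
      (jacobiTransform b θ (alpha a b θ + 1)) := by
  have hs := alpha_add_one_pos hθ hab
  refine ⟨degree_jacobiTransform hθ ha hs, degree_jacobiTransform hθ hb hs, fun n m => ?_⟩
  have hdeg : ∀ {c : ℝ}, -1 < c → ∀ {k}, k ≤ max n m →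
      (jacobiTransform c θ (alpha a b θ + 1) k).natDegree < max n m + 1 := fun hc k hk => by
    rw [Polynomial.natDegree_eq_of_degree_eq_some (degree_jacobiTransform hθ hc hs k)]
    exact Nat.lt_succ_of_le hk
  have hdiag := congrFun (congrFun (jacobiMatrix_mul_hilbertMatrix_mul_transpose hs (max n m + 1))
    ⟨n, Nat.lt_succ_of_le (le_max_left n m)⟩) ⟨m, Nat.lt_succ_of_le (le_max_right n m)⟩
  simp only [Matrix.mul_assoc, Matrix.diagonal_apply, Fin.mk.injEq] at hdiag
  rw [pairing_eq_dotProduct hθ ha hb hab (hdeg ha (le_max_left n m)) (hdeg hb (le_max_right n m)),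
    h_eq_inv hθ.ne']
  simp only [gammaCoeff_jacobiTransform hθ ha, gammaCoeff_jacobiTransform hθ hb]
  rw [div_eq_inv_mul, ← mul_zero θ⁻¹, ← mul_ite]
  exact congrArg (θ⁻¹ * ·) hdiag

end Biorthogonal

section GammaBounds

lemma norm_inv_Gamma_mul_exp_le {L : ℝ} {w : ℂ} (hw : Real.exp L ≤ ‖w - 1‖) :
    ‖(Complex.Gamma w)⁻¹‖ * Real.exp (L * w.re) ≤
      ‖(Complex.Gamma (w - 1))⁻¹‖ * Real.exp (L * (w - 1).re) := by
  have hpos : 0 < ‖w - 1‖ := (Real.exp_pos L).trans_le hw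
  have hGamma : Complex.Gamma w = (w - 1) * Complex.Gamma (w - 1) := by
    rw [← Complex.Gamma_add_one _ (norm_pos_iff.1 hpos), sub_add_cancel]
  have hexp : Real.exp (L * w.re) = Real.exp L * Real.exp (L * (w - 1).re) := by
    rw [← Real.exp_add, Complex.sub_re, Complex.one_re]
    ring_nf
  calc ‖(Complex.Gamma w)⁻¹‖ * Real.exp (L * w.re)
      = ‖w - 1‖⁻¹ * Real.exp L *
          (‖(Complex.Gamma (w - 1))⁻¹‖ * Real.exp (L * (w - 1).re)) := by
        rw [hGamma, hexp, mul_inv, norm_mul, norm_inv (w - 1)]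
        ring
    _ ≤ 1 * (‖(Complex.Gamma (w - 1))⁻¹‖ * Real.exp (L * (w - 1).re)) := by
        gcongr
        exact inv_mul_le_one_of_le₀ hw hpos.le
    _ = _ := one_mul _

lemma exists_norm_inv_Gamma_le (L x₀ B : ℝ) :
    ∃ M : ℝ, 0 ≤ M ∧ ∀ w : ℂ, x₀ ≤ w.re → |w.im| ≤ B →
      ‖(Complex.Gamma w)⁻¹‖ ≤ M * Real.exp (-L * w.re) := by
  set T : ℝ := max (x₀ + 1) (Real.exp L + 1)
  have hcont : Continuous fun w : ℂ => ‖(Complex.Gamma w)⁻¹‖ * Real.exp (L * w.re) := by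
    have := Complex.differentiable_one_div_Gamma.continuous
    fun_prop
  obtain ⟨M, hM⟩ := (isCompact_Icc.reProdIm isCompact_Icc :
    IsCompact (Icc x₀ T ×ℂ Icc (-B) B)).bddAbove_image hcont.continuousOn
  have hbound : ∀ n : ℕ, ∀ w : ℂ, x₀ ≤ w.re → w.re ≤ T + n → |w.im| ≤ B →
      ‖(Complex.Gamma w)⁻¹‖ * Real.exp (L * w.re) ≤ M := by
    intro n
    induction n with
    | zero =>
      intro w hx₀ hT hB
      rw [Nat.cast_zero, add_zero] at hT
      exact hM (mem_image_of_mem _ (Complex.mem_reProdIm.2 ⟨⟨hx₀, hT⟩, abs_le.1 hB⟩))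
    | succ n ih =>
      intro w hx₀ hT hB
      rcases le_or_gt w.re (T + n) with hle | hlt
      · exact ih w hx₀ hle hB
      have hx : x₀ + 1 ≤ T := le_max_left _ _
      have hL : Real.exp L + 1 ≤ T := le_max_right _ _
      have : (0 : ℝ) ≤ n := n.cast_nonneg
      push_cast at hT
      have hre : (w - 1).re = w.re - 1 := by simp
      exact (norm_inv_Gamma_mul_exp_le (le_trans (by linarith) (Complex.re_le_norm _))).trans
        (ih (w - 1) (by linarith) (by linarith) (by simpa using hB))
  refine ⟨max M 0, le_max_right _ _, fun w hx₀ hB => ?_⟩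
  obtain ⟨n, hn⟩ := exists_nat_ge (w.re - T)
  rw [neg_mul, Real.exp_neg, ← div_eq_mul_inv, le_div_iff₀ (Real.exp_pos _)]
  exact (hbound n w hx₀ (by linarith) hB).trans (le_max_left _ _)

lemma exists_norm_inv_Gamma_le_const (x₀ B : ℝ) :
    ∃ M : ℝ, 0 ≤ M ∧ ∀ w : ℂ, x₀ ≤ w.re → |w.im| ≤ B → ‖(Complex.Gamma w)⁻¹‖ ≤ M := by
  simpa using exists_norm_inv_Gamma_le 0 x₀ B

lemma sq_norm_sin (z : ℂ) :
    ‖Complex.sin z‖ ^ 2 = Real.sin z.re ^ 2 + Real.sinh z.im ^ 2 := by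
  rw [Complex.sin_eq, ← Complex.ofReal_sin, ← Complex.ofReal_cos, ← Complex.ofReal_sinh,
    ← Complex.ofReal_cosh, ← Complex.ofReal_mul, ← Complex.ofReal_mul, Complex.sq_norm,
    Complex.normSq_add_mul_I, mul_pow, mul_pow, Real.cosh_sq]
  linear_combination Real.sinh z.im ^ 2 * Real.sin_sq_add_cos_sq z.re

lemma abs_sin_re_le_norm_sin (z : ℂ) : |Real.sin z.re| ≤ ‖Complex.sin z‖ :=
  abs_le_of_sq_le_sq (by nlinarith [sq_norm_sin z]) (norm_nonneg _)

lemma abs_sinh_im_le_norm_sin (z : ℂ) : |Real.sinh z.im| ≤ ‖Complex.sin z‖ :=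
  abs_le_of_sq_le_sq (by nlinarith [sq_norm_sin z]) (norm_nonneg _)

lemma Gamma_eq_pi_mul_inv_sin_mul {u : ℂ} (hu : Complex.sin (Real.pi * u) ≠ 0) :
    Complex.Gamma u =
      Real.pi * (Complex.sin (Real.pi * u))⁻¹ * (Complex.Gamma (1 - u))⁻¹ := by
  have hrefl := Complex.Gamma_mul_Gamma_one_sub u
  have hne : Complex.Gamma (1 - u) ≠ 0 := right_ne_zero_of_mul
    (hrefl ▸ div_ne_zero (Complex.ofReal_ne_zero.2 Real.pi_ne_zero) hu)
  rw [eq_mul_inv_iff_mul_eq₀ hne, hrefl, div_eq_mul_inv]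

lemma norm_cpow_neg_le {z u : ℂ} (hz : z ≠ 0) {B : ℝ} (hB : |u.im| ≤ B) :
    ‖z ^ (-u)‖ ≤ Real.exp (-Real.log ‖z‖ * u.re) * Real.exp (Real.pi * B) := by
  have harg : z.arg * u.im ≤ Real.pi * B := by
    calc z.arg * u.im ≤ |z.arg| * |u.im| := (le_abs_self _).trans_eq (abs_mul _ _)
      _ ≤ Real.pi * B := by
        gcongr
        exact Complex.abs_arg_le_pi z
  rw [Complex.norm_cpow_of_ne_zero hz, div_eq_mul_inv, ← Real.exp_neg,
    Real.rpow_def_of_pos (norm_pos_iff.2 hz), Complex.neg_re, Complex.neg_im, mul_neg, neg_mul,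
    mul_neg, neg_neg]
  gcongr

/-- The decay `E u / Γ(1 - u) = O(e^{Re u})` in left half strips. By the reflection formula it is
what makes `∫ Γ(u) E(u) du` converge along a left loop, and vanish in the limit as the vertical
edge of the loop moves to `-∞` between the poles of `Γ`. -/
def HasGammaDecay (E : ℂ → ℂ) : Prop :=
  ∀ δ B : ℝ, ∃ C : ℝ, 0 ≤ C ∧ ∀ u : ℂ, u.re ≤ δ → |u.im| ≤ B →
    ‖E u * (Complex.Gamma (1 - u))⁻¹‖ ≤ C * Real.exp u.re

lemma HasGammaDecay.exists_norm_Gamma_mul_le {E : ℂ → ℂ} (hE : HasGammaDecay E) (δ B : ℝ) {s : ℝ}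
    (hs : 0 < s) :
    ∃ C : ℝ, 0 ≤ C ∧ ∀ u : ℂ, u.re ≤ δ → |u.im| ≤ B → s ≤ ‖Complex.sin (Real.pi * u)‖ →
      ‖Complex.Gamma u * E u‖ ≤ C * Real.exp u.re := by
  obtain ⟨C, hC0, hC⟩ := hE δ B
  refine ⟨Real.pi * s⁻¹ * C, by positivity, fun u hδ hB hsin => ?_⟩
  calc ‖Complex.Gamma u * E u‖
      = Real.pi * ‖Complex.sin (Real.pi * u)‖⁻¹ * ‖E u * (Complex.Gamma (1 - u))⁻¹‖ := by
        rw [Gamma_eq_pi_mul_inv_sin_mul (norm_pos_iff.1 (hs.trans_le hsin)), mul_assoc, norm_mul,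
          norm_mul, norm_inv, mul_comm (E u), Complex.norm_real, Real.norm_of_nonneg Real.pi_nonneg]
    _ ≤ Real.pi * s⁻¹ * (C * Real.exp u.re) := by
        gcongr
        exact hC u hδ hB
    _ = _ := by ring

/-- The entire factor `z^{-u} / (Γ(α-u+1) Γ(c-θu+1))` of `gIntegrand`. -/
noncomputable def gEntire (θ α c : ℝ) (z u : ℂ) : ℂ :=
  z ^ (-u) * (Complex.Gamma (α - u + 1))⁻¹ * (Complex.Gamma (c - θ * u + 1))⁻¹

lemma gIntegrand_eq_Gamma_mul (θ α c : ℝ) (z : ℂ) :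
    gIntegrand θ α c z = fun u => Complex.Gamma u * gEntire θ α c z u := by
  funext u
  rw [gIntegrand, gEntire, div_eq_mul_inv, mul_inv]
  ring

lemma differentiable_gEntire (θ α c : ℝ) {z : ℂ} (hz : z ≠ 0) :
    Differentiable ℂ (gEntire θ α c z) := by
  have hcpow : Differentiable ℂ fun u : ℂ => z ^ (-u) := fun u =>
    differentiableAt_id.neg.const_cpow (Or.inl hz)
  exact (hcpow.mul (Complex.differentiable_one_div_Gamma.comp (by fun_prop))).mul
    (Complex.differentiable_one_div_Gamma.comp (by fun_prop))

lemma hasGammaDecay_gEntire {θ : ℝ} (hθ : 0 ≤ θ) (α c : ℝ) {z : ℂ} (hz : z ≠ 0) :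
    HasGammaDecay (gEntire θ α c z) := by
  intro δ B
  set L : ℝ := Real.log ‖z‖ + 1 with hL
  obtain ⟨M₁, hM₁, hΓ₁⟩ := exists_norm_inv_Gamma_le L (1 - δ) B
  obtain ⟨M₂, hM₂, hΓ₂⟩ := exists_norm_inv_Gamma_le_const (α - δ + 1) B
  obtain ⟨M₃, hM₃, hΓ₃⟩ := exists_norm_inv_Gamma_le_const (c - θ * δ + 1) (θ * B)
  refine ⟨Real.exp (Real.pi * B) * M₂ * M₃ * M₁ * Real.exp (-L), by positivity,
    fun u hδ hB => ?_⟩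
  have hre₁ : (1 - u : ℂ).re = 1 - u.re := by simp
  have hre₂ : (α - u + 1 : ℂ).re = α - u.re + 1 := by simp
  have hre₃ : (c - θ * u + 1 : ℂ).re = c - θ * u.re + 1 := by simp
  have hθre : θ * u.re ≤ θ * δ := mul_le_mul_of_nonneg_left hδ hθ
  have hθim : |(c - θ * u + 1 : ℂ).im| ≤ θ * B := by
    simp only [Complex.add_im, Complex.sub_im, Complex.ofReal_im, Complex.im_ofReal_mul, zero_sub,
      Complex.one_im, add_zero, abs_neg, abs_mul, abs_of_nonneg hθ]
    gcongr
  have hexp : Real.exp (-Real.log ‖z‖ * u.re) * Real.exp (-L * (1 - u).re) =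
      Real.exp (-L) * Real.exp u.re := by
    rw [← Real.exp_add, ← Real.exp_add, hre₁, hL]
    ring_nf
  simp only [gEntire, norm_mul]
  calc _ ≤ Real.exp (-Real.log ‖z‖ * u.re) * Real.exp (Real.pi * B) * M₂ * M₃ *
        (M₁ * Real.exp (-L * (1 - u).re)) := by
        gcongr
        · exact norm_cpow_neg_le hz hB
        · exact hΓ₂ _ (by rw [hre₂]; linarith) (by simpa using hB)
        · exact hΓ₃ _ (by rw [hre₃]; linarith) hθim
        · exact hΓ₁ _ (by rw [hre₁]; linarith) (by simpa using hB)
    _ = Real.exp (Real.pi * B) * M₂ * M₃ * M₁ *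
        (Real.exp (-Real.log ‖z‖ * u.re) * Real.exp (-L * (1 - u).re)) := by ring
    _ = _ := by rw [hexp]; ring

end GammaBounds

section Rectangle

/-- The integral of `f` counterclockwise around the rectangle `[x₁, x₂] × [y₁, y₂]`, with the signs
of the edges arranged as in `Complex.integral_boundary_rect_eq_zero_of_differentiableOn`. -/
noncomputable def rectIntegral (f : ℂ → ℂ) (x₁ x₂ y₁ y₂ : ℝ) : ℂ :=
  (∫ x in x₁..x₂, f (x + y₁ * Complex.I)) - (∫ x in x₁..x₂, f (x + y₂ * Complex.I)) +
    Complex.I * (∫ y in y₁..y₂, f (x₂ + y * Complex.I)) -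
    Complex.I * ∫ y in y₁..y₂, f (x₁ + y * Complex.I)

/-- The boundary of the rectangle with opposite corners `x₁ + i y₁` and `x₂ + i y₂`. -/
def rectBoundary (x₁ x₂ y₁ y₂ : ℝ) : Set ℂ :=
  {u | u ∈ uIcc x₁ x₂ ×ℂ uIcc y₁ y₂ ∧ (u.re = x₁ ∨ u.re = x₂ ∨ u.im = y₁ ∨ u.im = y₂)}

variable {f g : ℂ → ℂ} {x₁ x₂ y₁ y₂ : ℝ} {p : ℂ}

lemma horizontal_mem_rectBoundary {x y : ℝ} (hx : x ∈ uIcc x₁ x₂) (hy : y = y₁ ∨ y = y₂) :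
    (x + y * Complex.I : ℂ) ∈ rectBoundary x₁ x₂ y₁ y₂ := by
  refine ⟨Complex.mem_reProdIm.2 ⟨by simpa using hx, ?_⟩, by simp [hy]⟩
  rcases hy with rfl | rfl <;> simp

lemma vertical_mem_rectBoundary {x y : ℝ} (hx : x = x₁ ∨ x = x₂) (hy : y ∈ uIcc y₁ y₂) :
    (x + y * Complex.I : ℂ) ∈ rectBoundary x₁ x₂ y₁ y₂ := by
  refine ⟨Complex.mem_reProdIm.2 ⟨?_, by simpa using hy⟩, ?_⟩
  all_goals rcases hx with rfl | rfl <;> simp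

lemma rectIntegral_congr (hfg : EqOn f g (rectBoundary x₁ x₂ y₁ y₂)) :
    rectIntegral f x₁ x₂ y₁ y₂ = rectIntegral g x₁ x₂ y₁ y₂ := by
  have hor : ∀ {y}, y = y₁ ∨ y = y₂ →
      ∫ x in x₁..x₂, f (x + y * Complex.I) = ∫ x in x₁..x₂, g (x + y * Complex.I) := fun hy =>
    intervalIntegral.integral_congr fun _ hx => hfg (horizontal_mem_rectBoundary hx hy)
  have vert : ∀ {x}, x = x₁ ∨ x = x₂ →
      ∫ y in y₁..y₂, f (x + y * Complex.I) = ∫ y in y₁..y₂, g (x + y * Complex.I) := fun hx =>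
    intervalIntegral.integral_congr fun _ hy => hfg (vertical_mem_rectBoundary hx hy)
  rw [rectIntegral, rectIntegral, hor (.inl rfl), hor (.inr rfl), vert (.inl rfl), vert (.inr rfl)]

lemma intervalIntegrable_horizontal (hf : ContinuousOn f (rectBoundary x₁ x₂ y₁ y₂)) {y : ℝ}
    (hy : y = y₁ ∨ y = y₂) :
    IntervalIntegrable (fun x : ℝ => f (x + y * Complex.I)) volume x₁ x₂ :=
  (hf.comp (by fun_prop) fun _ hx => horizontal_mem_rectBoundary hx hy).intervalIntegrable

lemma intervalIntegrable_vertical (hf : ContinuousOn f (rectBoundary x₁ x₂ y₁ y₂)) {x : ℝ}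
    (hx : x = x₁ ∨ x = x₂) :
    IntervalIntegrable (fun y : ℝ => f (x + y * Complex.I)) volume y₁ y₂ :=
  (hf.comp (by fun_prop) fun _ hy => vertical_mem_rectBoundary hx hy).intervalIntegrable

lemma rectIntegral_add (hf : ContinuousOn f (rectBoundary x₁ x₂ y₁ y₂))
    (hg : ContinuousOn g (rectBoundary x₁ x₂ y₁ y₂)) :
    rectIntegral (fun u => f u + g u) x₁ x₂ y₁ y₂ =
      rectIntegral f x₁ x₂ y₁ y₂ + rectIntegral g x₁ x₂ y₁ y₂ := by
  unfold rectIntegral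
  rw [intervalIntegral.integral_add (intervalIntegrable_horizontal hf (.inl rfl))
      (intervalIntegrable_horizontal hg (.inl rfl)),
    intervalIntegral.integral_add (intervalIntegrable_horizontal hf (.inr rfl))
      (intervalIntegrable_horizontal hg (.inr rfl)),
    intervalIntegral.integral_add (intervalIntegrable_vertical hf (.inl rfl))
      (intervalIntegrable_vertical hg (.inl rfl)),
    intervalIntegral.integral_add (intervalIntegrable_vertical hf (.inr rfl))
      (intervalIntegrable_vertical hg (.inr rfl))]
  ring

lemma rectIntegral_const_mul (r : ℂ) (f : ℂ → ℂ) (x₁ x₂ y₁ y₂ : ℝ) :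
    rectIntegral (fun u => r * f u) x₁ x₂ y₁ y₂ = r * rectIntegral f x₁ x₂ y₁ y₂ := by
  simp only [rectIntegral, intervalIntegral.integral_const_mul]
  ring

lemma notMem_rectBoundary (hre : p.re ∈ Ioo x₁ x₂) (him : p.im ∈ Ioo y₁ y₂) :
    p ∉ rectBoundary x₁ x₂ y₁ y₂ := by
  rintro ⟨-, h | h | h | h⟩
  · exact hre.1.ne' h
  · exact hre.2.ne h
  · exact him.1.ne' h
  · exact him.2.ne h

lemma continuousOn_inv_sub_rectBoundary (hre : p.re ∈ Ioo x₁ x₂) (him : p.im ∈ Ioo y₁ y₂) :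
    ContinuousOn (fun u => (u - p)⁻¹) (rectBoundary x₁ x₂ y₁ y₂) :=
  ContinuousOn.inv₀ (by fun_prop) fun _ hu =>
    sub_ne_zero.2 (ne_of_mem_of_not_mem hu (notMem_rectBoundary hre him))

lemma rect_mem_nhds (hre : p.re ∈ Ioo x₁ x₂) (him : p.im ∈ Ioo y₁ y₂) :
    uIcc x₁ x₂ ×ℂ uIcc y₁ y₂ ∈ 𝓝 p := by
  refine mem_of_superset ((isOpen_Ioo.reProdIm isOpen_Ioo).mem_nhds ⟨hre, him⟩) ?_
  exact fun u hu => ⟨Icc_subset_uIcc (Ioo_subset_Icc_self hu.1),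
    Icc_subset_uIcc (Ioo_subset_Icc_self hu.2)⟩

lemma log_sub_log_neg_of_im_pos {w : ℂ} (hw : 0 < w.im) :
    Complex.log w - Complex.log (-w) = Real.pi * Complex.I := by
  rw [Complex.log, Complex.log, norm_neg, Complex.arg_neg_eq_arg_sub_pi_of_im_pos hw]
  push_cast
  ring

lemma log_sub_log_neg_of_im_neg {w : ℂ} (hw : w.im < 0) :
    Complex.log w - Complex.log (-w) = -(Real.pi * Complex.I) := by
  rw [← log_sub_log_neg_of_im_pos (w := -w) (by simpa using hw), neg_neg, neg_sub]

lemma integral_inv_sub_horizontal {y : ℝ} (hy : y ≠ p.im)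
    (hint : IntervalIntegrable (fun x : ℝ => (x + y * Complex.I - p)⁻¹) volume x₁ x₂) :
    ∫ x in x₁..x₂, (x + y * Complex.I - p)⁻¹ =
      Complex.log (x₂ + y * Complex.I - p) - Complex.log (x₁ + y * Complex.I - p) := by
  refine intervalIntegral.integral_eq_sub_of_hasDerivAt
    (f := fun x : ℝ => Complex.log (x + y * Complex.I - p)) (fun x _ => ?_) hint
  have hderiv : HasDerivAt (fun x : ℝ => (x + y * Complex.I - p : ℂ)) 1 x :=
    (Complex.ofRealCLM.hasDerivAt.add_const _).sub_const _
  simpa using hderiv.clog_real (.inr (by simpa [sub_eq_zero] using hy))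

lemma integral_inv_sub_vertical {x : ℝ} {e : ℂ} (he : e ≠ 0)
    (hslit : ∀ y : ℝ, e * (x + y * Complex.I - p) ∈ Complex.slitPlane)
    (hint : IntervalIntegrable (fun y : ℝ => (x + y * Complex.I - p)⁻¹) volume y₁ y₂) :
    Complex.I * ∫ y in y₁..y₂, (x + y * Complex.I - p)⁻¹ =
      Complex.log (e * (x + y₂ * Complex.I - p)) - Complex.log (e * (x + y₁ * Complex.I - p)) := by
  rw [← intervalIntegral.integral_const_mul]
  refine intervalIntegral.integral_eq_sub_of_hasDerivAt
    (f := fun y : ℝ => Complex.log (e * (x + y * Complex.I - p))) (fun y _ => ?_)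
    (hint.const_mul _)
  have hderiv : HasDerivAt (fun y : ℝ => e * (x + y * Complex.I - p : ℂ)) (e * (1 * Complex.I)) y :=
    (((Complex.ofRealCLM.hasDerivAt.mul_const _).const_add _).sub_const _).const_mul _
  convert! hderiv.clog_real (hslit y) using 1
  have : (x + y * Complex.I - p : ℂ) ≠ 0 :=
    right_ne_zero_of_mul (Complex.slitPlane_ne_zero (hslit y))
  field_simp

/-- On the left edge `log (u - p)` is replaced by `log (p - u)` in order to avoid the branch cut;
the two differ by `±πi` above and below `p`, and these two jumps add up to `2πi`. -/
lemma rectIntegral_inv_sub (hre : p.re ∈ Ioo x₁ x₂) (him : p.im ∈ Ioo y₁ y₂) :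
    rectIntegral (fun u => (u - p)⁻¹) x₁ x₂ y₁ y₂ = 2 * Real.pi * Complex.I := by
  have hcont := continuousOn_inv_sub_rectBoundary hre him
  have hlower := integral_inv_sub_horizontal him.1.ne
    (intervalIntegrable_horizontal hcont (.inl rfl))
  have hupper := integral_inv_sub_horizontal him.2.ne'
    (intervalIntegrable_horizontal hcont (.inr rfl))
  have hright := integral_inv_sub_vertical one_ne_zero (fun y => .inl (by simpa using hre.2))
    (intervalIntegrable_vertical hcont (.inr rfl))
  have hleft := integral_inv_sub_vertical (neg_ne_zero.2 one_ne_zero)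
    (fun y => .inl (by simpa using hre.1)) (intervalIntegrable_vertical hcont (.inl rfl))
  have habove := log_sub_log_neg_of_im_pos (w := x₁ + y₂ * Complex.I - p) (by simpa using him.2)
  have hbelow := log_sub_log_neg_of_im_neg (w := x₁ + y₁ * Complex.I - p) (by simpa using him.1)
  rw [rectIntegral, hlower, hupper, hright, hleft]
  simp only [one_mul, neg_one_mul]
  linear_combination habove - hbelow

lemma rectIntegral_div_sub (hre : p.re ∈ Ioo x₁ x₂) (him : p.im ∈ Ioo y₁ y₂)
    (hf : DifferentiableOn ℂ f (uIcc x₁ x₂ ×ℂ uIcc y₁ y₂)) :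
    rectIntegral (fun u => f u / (u - p)) x₁ x₂ y₁ y₂ = 2 * Real.pi * Complex.I * f p := by
  have hslope : DifferentiableOn ℂ (dslope f p) (uIcc x₁ x₂ ×ℂ uIcc y₁ y₂) :=
    (Complex.differentiableOn_dslope (rect_mem_nhds hre him)).2 hf
  have hsplit : EqOn (fun u => f u / (u - p)) (fun u => dslope f p u + f p * (u - p)⁻¹)
      (rectBoundary x₁ x₂ y₁ y₂) := fun u hu => by
    have hne : u ≠ p := ne_of_mem_of_not_mem hu (notMem_rectBoundary hre him)
    beta_reduce
    rw [dslope_of_ne _ hne, slope_def_field, ← div_eq_mul_inv, ← add_div, sub_add_cancel]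
  have hzero : rectIntegral (dslope f p) x₁ x₂ y₁ y₂ = 0 := by
    simpa [rectIntegral] using Complex.integral_boundary_rect_eq_zero_of_differentiableOn
      (dslope f p) (x₁ + y₁ * Complex.I) (x₂ + y₂ * Complex.I) (by simpa using hslope)
  rw [rectIntegral_congr hsplit, rectIntegral_add (hslope.continuousOn.mono fun u hu => hu.1)
    ((continuousOn_inv_sub_rectBoundary hre him).const_mul (f p)), rectIntegral_const_mul, hzero,
    rectIntegral_inv_sub hre him]
  ring

lemma rectIntegral_eq_of_simplePole (hre : p.re ∈ Ioo x₁ x₂) (him : p.im ∈ Ioo y₁ y₂)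
    (hf : DifferentiableOn ℂ f ((uIcc x₁ x₂ ×ℂ uIcc y₁ y₂) \ {p})) {r : ℂ}
    (hr : Tendsto (fun u => (u - p) * f u) (𝓝[≠] p) (𝓝 r)) :
    rectIntegral f x₁ x₂ y₁ y₂ = 2 * Real.pi * Complex.I * r := by
  set F := Function.update (fun u => (u - p) * f u) p r
  have hFp : F p = r := Function.update_self ..
  have hF : ∀ u ≠ p, F u = (u - p) * f u := fun u hu => Function.update_of_ne hu _ _
  have hdiff : DifferentiableOn ℂ F (uIcc x₁ x₂ ×ℂ uIcc y₁ y₂) :=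
    (Complex.differentiableOn_compl_singleton_and_continuousAt_iff (rect_mem_nhds hre him)).1
      ⟨(DifferentiableOn.mul (by fun_prop) hf).congr fun u hu => hF u hu.2,
        continuousAt_update_same.2 hr⟩
  have hdiv : EqOn f (fun u => F u / (u - p)) (rectBoundary x₁ x₂ y₁ y₂) := fun u hu => by
    have hne : u ≠ p := ne_of_mem_of_not_mem hu (notMem_rectBoundary hre him)
    beta_reduce
    rw [hF u hne, mul_div_cancel_left₀ _ (sub_ne_zero.2 hne)]
  rw [rectIntegral_congr hdiv, rectIntegral_div_sub hre him hdiff, hFp]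

end Rectangle

section Residues

lemma tendsto_add_natCast_mul_Gamma (k : ℕ) :
    Tendsto (fun u : ℂ => (u + k) * Complex.Gamma u) (𝓝[≠] (-k)) (𝓝 ((-1) ^ k / k.factorial)) := by
  induction k with
  | zero => simpa using Complex.tendsto_self_mul_Gamma_nhds_zero
  | succ k ih =>
    have hne : (-(k + 1 : ℕ) : ℂ) ≠ 0 := neg_ne_zero.2 (Nat.cast_ne_zero.2 k.succ_ne_zero)
    have hshift : Tendsto (fun u : ℂ => u + 1) (𝓝[≠] (-(k + 1 : ℕ))) (𝓝[≠] (-k)) := by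
      refine tendsto_nhdsWithin_iff.2 ⟨?_, ?_⟩
      · refine Tendsto.mono_left ?_ nhdsWithin_le_nhds
        simpa using (continuous_add_const (1 : ℂ)).tendsto (-(k + 1 : ℕ))
      · filter_upwards [self_mem_nhdsWithin] with u hu h
        refine hu (mem_singleton_iff.2 ?_)
        push_cast
        linear_combination mem_singleton_iff.1 h
    have hdiv := (ih.comp hshift).div (tendsto_nhdsWithin_of_tendsto_nhds tendsto_id) hne
    refine (hdiv.congr' ?_).trans_eq ?_
    · filter_upwards [nhdsWithin_le_nhds (isOpen_ne.mem_nhds hne)] with u hu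
      rw [Pi.div_apply, Function.comp_apply, Complex.Gamma_add_one u hu, id, Nat.cast_add_one]
      field_simp
      ring
    · rw [Nat.factorial_succ, pow_succ]
      push_cast
      field_simp

/-- The residues of `Γ E` at the poles of `Γ`, for `E` entire. -/
noncomputable def gammaResidue (E : ℂ → ℂ) (k : ℕ) : ℂ := (-1) ^ k / k.factorial * E (-k)

variable {E : ℂ → ℂ}

lemma continuousOn_Gamma_mul (hE : Continuous E) {s : Set ℂ} (hs : ∀ m : ℕ, (-m : ℂ) ∉ s) :
    ContinuousOn (fun u => Complex.Gamma u * E u) s := fun u hu =>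
  ((Complex.differentiableAt_Gamma u fun m h => hs m (h ▸ hu)).continuousAt.mul
    hE.continuousAt).continuousWithinAt

lemma rectIntegral_Gamma_mul (hE : Differentiable ℂ E) {k : ℕ} {x₁ x₂ y₁ y₂ : ℝ}
    (hk : (-k : ℝ) ∈ Ioo x₁ x₂) (him : (0 : ℝ) ∈ Ioo y₁ y₂)
    (hpole : ∀ m : ℕ, (-m : ℝ) ∈ Icc x₁ x₂ → m = k) :
    rectIntegral (fun u => Complex.Gamma u * E u) x₁ x₂ y₁ y₂ =
      2 * Real.pi * Complex.I * gammaResidue E k := by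
  refine rectIntegral_eq_of_simplePole (p := -k) (by simpa using hk) (by simpa using him)
    (fun u hu => ?_) ?_
  · have hGamma : DifferentiableAt ℂ Complex.Gamma u :=
      Complex.differentiableAt_Gamma u fun m h => hu.2 (by
        have hmem := hu.1.1
        rw [h, uIcc_of_le (hk.1.trans hk.2).le] at hmem
        rw [h, hpole m (by simpa using hmem), mem_singleton_iff])
    exact (hGamma.mul hE.differentiableAt).differentiableWithinAt
  · have hEk : Tendsto E (𝓝[≠] (-k)) (𝓝 (E (-k))) :=
      hE.continuous.continuousAt.tendsto.mono_left nhdsWithin_le_nhds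
    simpa only [sub_neg_eq_add, mul_assoc, gammaResidue] using
      (tendsto_add_natCast_mul_Gamma k).mul hEk

lemma HasGammaDecay.summable_norm_gammaResidue (hE : HasGammaDecay E) :
    Summable fun k => ‖gammaResidue E k‖ := by
  obtain ⟨C, -, hC⟩ := hE 0 0
  refine Summable.of_nonneg_of_le (fun k => norm_nonneg _) (fun k => ?_)
    (Real.summable_exp_neg_nat.mul_left C)
  have hk := hC (-k) (by simp) (by simp)
  rw [sub_neg_eq_add, add_comm, Complex.Gamma_nat_eq_factorial, mul_comm, ← div_eq_inv_mul] at hk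
  simpa [gammaResidue, div_mul_eq_mul_div] using hk

end Residues

section Loop

namespace LeftLoop

/-- The points on the path of the loop. -/
def path (γ : LeftLoop) : Set ℂ :=
  {u | u.re ≤ γ.right ∧ u.im ∈ Icc γ.lower γ.upper ∧
    (u.im = γ.lower ∨ u.im = γ.upper ∨ u.re = γ.right)}

/-- The loop with the same horizontal lines and with vertical edge at abscissa `x`. -/
def withRight (γ : LeftLoop) (x : ℝ) : LeftLoop := { γ with right := x }

variable {γ : LeftLoop} {f : ℂ → ℂ} {C : ℝ}

lemma lower_mem_path {x : ℝ} (hx : x ≤ γ.right) : (x + γ.lower * Complex.I : ℂ) ∈ γ.path := by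
  simpa [path, hx] using γ.lower_lt_upper.le

lemma upper_mem_path {x : ℝ} (hx : x ≤ γ.right) : (x + γ.upper * Complex.I : ℂ) ∈ γ.path := by
  simpa [path, hx] using γ.lower_lt_upper.le

lemma right_mem_path {y : ℝ} (hy : y ∈ Icc γ.lower γ.upper) :
    (γ.right + y * Complex.I : ℂ) ∈ γ.path := by
  simpa [path] using hy

lemma integrable_of_norm_le (hf : ContinuousOn f γ.path)
    (hC : ∀ u ∈ γ.path, u.im = γ.lower ∨ u.im = γ.upper → ‖f u‖ ≤ C * Real.exp u.re) :
    γ.Integrable f := by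
  have hor : ∀ y : ℝ, y = γ.lower ∨ y = γ.upper →
      (∀ x ≤ γ.right, (x + y * Complex.I : ℂ) ∈ γ.path) →
      IntegrableOn (fun x : ℝ => f (x + y * Complex.I)) (Iic γ.right) := by
    intro y hy hmem
    refine ((integrableOn_exp_Iic γ.right).const_mul C).mono'
      ((hf.comp (by fun_prop) hmem).aestronglyMeasurable measurableSet_Iic)
      ((ae_restrict_iff' measurableSet_Iic).2 (.of_forall fun x hx => ?_))
    simpa using hC _ (hmem x hx) (by simpa using hy)
  refine ⟨hor _ (.inl rfl) fun _ => lower_mem_path, ?_, hor _ (.inr rfl) fun _ => upper_mem_path⟩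
  refine (hf.comp (by fun_prop) fun y hy => right_mem_path ?_).intervalIntegrable
  rwa [uIcc_of_le γ.lower_lt_upper.le] at hy

lemma integral_sub_integral_withRight (hf : γ.Integrable f) {x : ℝ} (hx : x ≤ γ.right) :
    γ.integral f - (γ.withRight x).integral f =
      (2 * Real.pi * Complex.I)⁻¹ * rectIntegral f x γ.right γ.lower γ.upper := by
  have hlower := intervalIntegral.integral_Iic_sub_Iic (hf.1.mono_set (Iic_subset_Iic.2 hx)) hf.1
  have hupper :=
    intervalIntegral.integral_Iic_sub_Iic (hf.2.2.mono_set (Iic_subset_Iic.2 hx)) hf.2.2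
  simp only [integral, rectIntegral, withRight]
  rw [← hlower, ← hupper]
  ring

lemma norm_integral_le (hC : ∀ u ∈ γ.path, ‖f u‖ ≤ C * Real.exp u.re) :
    ‖γ.integral f‖ ≤ ‖(2 * Real.pi * Complex.I : ℂ)⁻¹‖ *
      (C * (2 + (γ.upper - γ.lower))) * Real.exp γ.right := by
  have hor : ∀ y : ℝ, (∀ x ≤ γ.right, (x + y * Complex.I : ℂ) ∈ γ.path) →
      ‖∫ x in Iic γ.right, f (x + y * Complex.I)‖ ≤ C * Real.exp γ.right := by
    intro y hmem
    rw [← integral_exp_Iic, ← integral_const_mul]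
    refine norm_integral_le_of_norm_le ((integrableOn_exp_Iic γ.right).const_mul C)
      ((ae_restrict_iff' measurableSet_Iic).2 (.of_forall fun x hx => ?_))
    simpa using hC _ (hmem x hx)
  have hright : ‖∫ y in γ.lower..γ.upper, f (γ.right + y * Complex.I)‖ ≤
      C * Real.exp γ.right * (γ.upper - γ.lower) := by
    rw [← abs_of_pos (sub_pos.2 γ.lower_lt_upper)]
    refine intervalIntegral.norm_integral_le_of_norm_le_const fun y hy => ?_
    rw [uIoc_of_le γ.lower_lt_upper.le] at hy
    simpa using hC _ (right_mem_path (Ioc_subset_Icc_self hy))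
  rw [← one_mul ‖_‖, ← Complex.norm_I, ← norm_mul] at hright
  have hsum := norm_sub_le_of_le (norm_add_le_of_le (hor _ fun _ => lower_mem_path) hright)
    (hor _ fun _ => upper_mem_path)
  rw [integral, norm_mul, mul_assoc ‖_‖]
  exact mul_le_mul_of_nonneg_left (hsum.trans_eq (by ring)) (norm_nonneg _)

/-- Abscissae of vertical edges that separate the poles of `Γ`: only the pole `-n` lies between
`γ.cut (n + 1)` and `γ.cut n`. -/
noncomputable def cut (γ : LeftLoop) : ℕ → ℝ
  | 0 => γ.right
  | n + 1 => -(n + 1 / 2)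

lemma cut_succ_lt (n : ℕ) : γ.cut (n + 1) < -n := by
  rw [cut]
  linarith

lemma lt_cut (hr : 0 < γ.right) (n : ℕ) : -n < γ.cut n := by
  cases n with
  | zero => simpa [cut] using hr
  | succ n =>
    rw [cut]
    push_cast
    linarith

lemma cut_ne_neg_natCast (hr : 0 < γ.right) (n m : ℕ) : γ.cut n ≠ -m := by
  cases n with
  | zero => exact ((neg_nonpos.2 m.cast_nonneg).trans_lt hr).ne'
  | succ n =>
    intro h
    rw [cut] at h
    have : 2 * n + 1 = 2 * m := by exact_mod_cast (by linarith : (2 * n + 1 : ℝ) = 2 * m)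
    omega

lemma eq_of_neg_natCast_mem_Icc_cut {m n : ℕ} (hm : (-m : ℝ) ∈ Icc (γ.cut (n + 1)) (γ.cut n)) :
    m = n := by
  obtain ⟨hlower, hupper⟩ := hm
  rw [cut] at hlower
  have hle : m < n + 1 := by exact_mod_cast (by linarith : (m : ℝ) < n + 1)
  cases n with
  | zero => omega
  | succ n =>
    rw [cut] at hupper
    have hge : n < m := by exact_mod_cast (by linarith : (n : ℝ) < m)
    omega

lemma cut_le_right (hr : 0 < γ.right) (n : ℕ) : γ.cut n ≤ γ.right := by
  cases n with
  | zero => exact le_rfl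
  | succ n => exact (cut_succ_lt n).le.trans ((neg_nonpos.2 n.cast_nonneg).trans hr.le)

lemma abs_sin_pi_mul_cut_succ (n : ℕ) : |Real.sin (Real.pi * γ.cut (n + 1))| = 1 := by
  rw [cut, show Real.pi * -(n + 1 / 2 : ℝ) = -(n * Real.pi + Real.pi / 2) by ring, Real.sin_neg,
    Real.sin_add_pi_div_two, Real.cos_nat_mul_pi, abs_neg, abs_pow, abs_neg, abs_one, one_pow]

lemma tendsto_exp_cut : Tendsto (fun n => Real.exp (γ.cut (n + 1))) atTop (𝓝 0) := by
  refine Real.tendsto_exp_atBot.comp (tendsto_neg_atTop_atBot.comp ?_)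
  exact tendsto_atTop_add_const_right _ _ tendsto_natCast_atTop_atTop

end LeftLoop

variable {γ : LeftLoop} {E : ℂ → ℂ}

lemma HasGammaDecay.exists_norm_Gamma_mul_le_of_edge (hE : HasGammaDecay E) (hl : γ.lower < 0)
    (hu : 0 < γ.upper) :
    ∃ C : ℝ, 0 ≤ C ∧ ∀ u : ℂ, u.re ≤ γ.right → u.im ∈ Icc γ.lower γ.upper →
      u.im = γ.lower ∨ u.im = γ.upper ∨ |Real.sin (Real.pi * u.re)| = 1 →
      ‖Complex.Gamma u * E u‖ ≤ C * Real.exp u.re := by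
  have hsinh : ∀ {y : ℝ}, y ≠ 0 → 0 < |Real.sinh (Real.pi * y)| := fun hy =>
    abs_pos.2 (Real.sinh_ne_zero.2 (mul_ne_zero Real.pi_ne_zero hy))
  obtain ⟨C, hC0, hC⟩ := hE.exists_norm_Gamma_mul_le γ.right (max |γ.lower| |γ.upper|)
    (lt_min one_pos (lt_min (hsinh hl.ne) (hsinh hu.ne')))
  refine ⟨C, hC0, fun u hre him hedge => hC u hre (abs_le_max_abs_abs him.1 him.2) ?_⟩
  have hsin_re := abs_sin_re_le_norm_sin (Real.pi * u)
  have hsin_im := abs_sinh_im_le_norm_sin (Real.pi * u)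
  rw [Complex.re_ofReal_mul] at hsin_re
  rw [Complex.im_ofReal_mul] at hsin_im
  rcases hedge with h | h | h
  · exact (min_le_right _ _).trans ((min_le_left _ _).trans (h ▸ hsin_im))
  · exact (min_le_right _ _).trans ((min_le_right _ _).trans (h ▸ hsin_im))
  · exact (min_le_left _ _).trans (h ▸ hsin_re)

lemma integrable_Gamma_mul (hE : Continuous E) (hdecay : HasGammaDecay E) (hl : γ.lower < 0)
    (hu : 0 < γ.upper) (hr : ∀ m : ℕ, γ.right ≠ -m) :
    γ.Integrable fun u => Complex.Gamma u * E u := by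
  obtain ⟨C, -, hC⟩ := hdecay.exists_norm_Gamma_mul_le_of_edge hl hu
  refine LeftLoop.integrable_of_norm_le (continuousOn_Gamma_mul hE ?_) fun u hpath him =>
    hC u hpath.1 hpath.2.1 (by tauto)
  rintro m ⟨-, -, h | h | h⟩
  · exact hl.ne' (by simpa using h)
  · exact hu.ne (by simpa using h)
  · exact hr m (by simpa using h.symm)

lemma integral_withRight_cut_sub (hE : Differentiable ℂ E) (hdecay : HasGammaDecay E)
    (hγ : γ.Encloses 0) (n : ℕ) :
    (γ.withRight (γ.cut n)).integral (fun u => Complex.Gamma u * E u) -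
      (γ.withRight (γ.cut (n + 1))).integral (fun u => Complex.Gamma u * E u) =
      gammaResidue E n := by
  obtain ⟨hr, hl, hu⟩ := hγ
  have hcut : γ.cut (n + 1) < γ.cut n :=
    (LeftLoop.cut_succ_lt n).trans (LeftLoop.lt_cut hr n)
  have hint := integrable_Gamma_mul (γ := γ.withRight (γ.cut n)) hE.continuous hdecay hl hu
    (LeftLoop.cut_ne_neg_natCast hr n)
  refine (LeftLoop.integral_sub_integral_withRight hint hcut.le).trans ?_
  rw [LeftLoop.withRight, rectIntegral_Gamma_mul hE
    ⟨LeftLoop.cut_succ_lt n, LeftLoop.lt_cut hr n⟩ ⟨hl, hu⟩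
    fun m => LeftLoop.eq_of_neg_natCast_mem_Icc_cut, inv_mul_cancel_left₀ Complex.two_pi_I_ne_zero]

lemma tendsto_integral_withRight_cut (hdecay : HasGammaDecay E) (hγ : γ.Encloses 0) :
    Tendsto (fun n => (γ.withRight (γ.cut n)).integral fun u => Complex.Gamma u * E u)
      atTop (𝓝 0) := by
  obtain ⟨hr, hl, hu⟩ := hγ
  obtain ⟨C, -, hC⟩ := hdecay.exists_norm_Gamma_mul_le_of_edge hl hu
  have hexp := (LeftLoop.tendsto_exp_cut (γ := γ)).const_mul
    (‖(2 * Real.pi * Complex.I : ℂ)⁻¹‖ * (C * (2 + (γ.upper - γ.lower))))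
  rw [mul_zero] at hexp
  rw [← tendsto_add_atTop_iff_nat 1]
  refine squeeze_zero_norm (fun n => LeftLoop.norm_integral_le ?_) hexp
  rintro u ⟨hre, him, hedge⟩
  exact hC u (hre.trans (LeftLoop.cut_le_right hr (n + 1))) him
    (hedge.imp_right (Or.imp_right fun h : u.re = γ.cut (n + 1) =>
      h ▸ LeftLoop.abs_sin_pi_mul_cut_succ n))

lemma hasSum_gammaResidue (hE : Differentiable ℂ E) (hdecay : HasGammaDecay E)
    (hγ : γ.Encloses 0) :
    HasSum (gammaResidue E) (γ.integral fun u => Complex.Gamma u * E u) := by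
  rw [hdecay.summable_norm_gammaResidue.of_norm.hasSum_iff_tendsto_nat]
  have hsum : ∀ n, ∑ k ∈ Finset.range n, gammaResidue E k =
      γ.integral (fun u => Complex.Gamma u * E u) -
        (γ.withRight (γ.cut n)).integral fun u => Complex.Gamma u * E u := fun n => by
    simp only [← integral_withRight_cut_sub hE hdecay hγ]
    exact Finset.sum_range_sub' _ n
  simpa only [hsum, sub_zero] using (tendsto_integral_withRight_cut hdecay hγ).const_sub _

end Loop

section FoxFunction

variable {γ : LeftLoop} {θ : ℝ} {z : ℂ}

/-- The coefficients of the power series of `gInf`. -/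
noncomputable def gTerm (θ α c : ℝ) (z : ℂ) (k : ℕ) : ℂ :=
  (-1) ^ k * z ^ k /
    (k.factorial * Complex.Gamma (α + k + 1) * Complex.Gamma (c + θ * k + 1))

lemma gammaResidue_gEntire (θ α c : ℝ) (z : ℂ) :
    gammaResidue (gEntire θ α c z) = gTerm θ α c z := by
  funext k
  rw [gammaResidue, gEntire, gTerm, neg_neg, Complex.cpow_natCast, sub_neg_eq_add, mul_neg,
    sub_neg_eq_add]
  simp only [div_eq_mul_inv, mul_inv]
  ring

lemma summable_norm_gTerm (hθ : 0 ≤ θ) (α c : ℝ) (hz : z ≠ 0) :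
    Summable fun k => ‖gTerm θ α c z k‖ :=
  gammaResidue_gEntire θ α c z ▸ (hasGammaDecay_gEntire hθ α c hz).summable_norm_gammaResidue

lemma hasSum_gTerm (hθ : 0 ≤ θ) (α c : ℝ) (hz : z ≠ 0) (hγ : γ.Encloses 0) :
    HasSum (gTerm θ α c z) (gInf γ θ α c z) := by
  rw [← gammaResidue_gEntire, gInf, gIntegrand_eq_Gamma_mul]
  exact hasSum_gammaResidue (differentiable_gEntire θ α c hz) (hasGammaDecay_gEntire hθ α c hz) hγ

lemma integrable_gIntegrand (hθ : 0 ≤ θ) (α c : ℝ) (hz : z ≠ 0) (hγ : γ.Encloses 0) :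
    γ.Integrable (gIntegrand θ α c z) := by
  rw [gIntegrand_eq_Gamma_mul]
  exact integrable_Gamma_mul (differentiable_gEntire θ α c hz).continuous
    (hasGammaDecay_gEntire hθ α c hz) hγ.2.1 hγ.2.2
    fun m => ((neg_nonpos.2 m.cast_nonneg).trans_lt hγ.1).ne'

lemma foxIntegrand_eq_gIntegrand (θ α c : ℝ) (z : ℂ) :
    foxIntegrand 1 0 ![] ![] ![0, -(α : ℂ), -(c : ℂ)] ![1, 1, θ] z = gIntegrand θ α c z := by
  funext u
  have hfox : foxIntegrand 1 0 ![] ![] ![0, -(α : ℂ), -(c : ℂ)] ![1, 1, θ] z u =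
      Complex.Gamma u / (Complex.Gamma (1 + α - u) * Complex.Gamma (1 + c - θ * u)) * z ^ (-u) := by
    simp [foxIntegrand, Finset.prod_filter, Fin.prod_univ_three]
  rw [hfox, gIntegrand, div_mul_eq_mul_div, add_comm (1 : ℂ) α, add_comm (1 : ℂ) c,
    add_sub_right_comm, add_sub_right_comm]

lemma foxSuitable_of_encloses_zero (hθ : 0 ≤ θ) (α c : ℝ) (hz : z ≠ 0) (hγ : γ.Encloses 0) :
    FoxSuitable 1 0 ![] ![] ![0, -(α : ℂ), -(c : ℂ)] ![1, 1, θ] z γ := by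
  refine ⟨fun j hj k => ?_, fun j => j.elim0, ?_⟩
  · obtain rfl : j = 0 := Fin.ext (by simpa using hj)
    have hk : (-k : ℝ) < γ.right := (neg_nonpos.2 k.cast_nonneg).trans_lt hγ.1
    simpa [LeftLoop.Encloses] using And.intro hk hγ.2
  · rw [foxIntegrand_eq_gIntegrand]
    exact integrable_gIntegrand hθ α c hz hγ

end FoxFunction

section KernelAsymptotics

/-- The normalisation `(s)_N / (N! N^{s-1})` of the Pochhammer symbol, which tends to `1/Γ(s)`. -/
noncomputable def growthFactor (s : ℝ) (N : ℕ) : ℝ :=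
  (ascPochhammer ℝ N).eval s / N.factorial * N / (N : ℝ) ^ s

lemma tendsto_growthFactor {s : ℝ} (hs : 0 < s) :
    Tendsto (growthFactor s) atTop (𝓝 (Real.Gamma s)⁻¹) := by
  have hseq := ((Real.GammaSeq_tendsto_Gamma s).inv₀ (Real.Gamma_pos_of_pos hs).ne').mul
    (tendsto_natCast_div_add_atTop s)
  rw [mul_one] at hseq
  refine hseq.congr fun N => ?_
  have hN : (N + s : ℝ) ≠ 0 := by positivity
  rw [Real.GammaSeq, growthFactor, prod_range_add_natCast_eq_eval_ascPochhammer,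
    ascPochhammer_succ_eval, add_comm s]
  field_simp

lemma growthFactor_nonneg {s : ℝ} (hs : 0 < s) (N : ℕ) : 0 ≤ growthFactor s N := by
  have := (ascPochhammer_pos N s hs).le
  unfold growthFactor
  positivity

lemma eval_ascPochhammer_add_one_mul (s : ℝ) (N : ℕ) :
    (ascPochhammer ℝ N).eval (s + 1) * s = (ascPochhammer ℝ N).eval s * (s + N) := by
  rw [← ascPochhammer_succ_eval, ascPochhammer_succ_left, Polynomial.eval_mul, Polynomial.eval_X,
    Polynomial.eval_comp, Polynomial.eval_add, Polynomial.eval_X, Polynomial.eval_one, mul_comm]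

lemma growthFactor_add_one_le {s : ℝ} (hs : 0 < s) (N : ℕ) :
    growthFactor (s + 1) N ≤ growthFactor s N * (1 + s⁻¹) := by
  obtain rfl | hN := N.eq_zero_or_pos
  · simp [growthFactor]
  have hN0 : (0 : ℝ) < N := Nat.cast_pos.2 hN
  have hrec : growthFactor (s + 1) N = growthFactor s N * ((N : ℝ)⁻¹ + s⁻¹) := by
    have : (0 : ℝ) < (N : ℝ) ^ s := Real.rpow_pos_of_pos hN0 s
    rw [growthFactor, growthFactor, Real.rpow_add_one hN0.ne',
      eq_div_of_mul_eq hs.ne' (eval_ascPochhammer_add_one_mul s N)]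
    field_simp
  rw [hrec]
  refine mul_le_mul_of_nonneg_left (add_le_add_left ?_ _) (growthFactor_nonneg hs N)
  exact inv_le_one_of_one_le₀ (Nat.one_le_cast.2 hN)

lemma growthFactor_add_natCast_le {s : ℝ} (hs : 0 < s) (N k : ℕ) :
    growthFactor (s + k) N ≤ growthFactor s N * (1 + s⁻¹) ^ k := by
  induction k with
  | zero => simp
  | succ k ih =>
    have hsk : 0 < s + k := by positivity
    rw [Nat.cast_succ, ← add_assoc, pow_succ, ← mul_assoc]
    refine (growthFactor_add_one_le hsk N).trans (mul_le_mul ih ?_ (by positivity)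
      (mul_nonneg (growthFactor_nonneg hs N) (by positivity)))
    gcongr
    exact le_add_of_nonneg_right k.cast_nonneg

/-- The kernel factors with their growth `N^{s+2k}` divided out. -/
noncomputable def rescaledFactor (s : ℝ) (N k : ℕ) : ℝ :=
  kernelFactor s N k / ((N : ℝ) ^ s * ((N : ℝ) ^ 2) ^ k)

lemma rescaledFactor_eq_zero_of_le (s : ℝ) {N k : ℕ} (hk : N ≤ k) : rescaledFactor s N k = 0 := by
  rw [rescaledFactor, kernelFactor]
  obtain rfl | hlt := hk.eq_or_lt
  · simp
  · simp [jacobiCoeff_eq_zero_of_lt s hlt]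

lemma rescaledFactor_eq (s : ℝ) (N k : ℕ) :
    rescaledFactor s N k =
      (-1) ^ k * (N.choose k / (N : ℝ) ^ k) * ((N - k) / N) * growthFactor (s + k) N := by
  obtain rfl | hN := N.eq_zero_or_pos
  · rw [rescaledFactor_eq_zero_of_le s k.zero_le]
    simp
  have hN0 : (0 : ℝ) < N := Nat.cast_pos.2 hN
  have : (0 : ℝ) < (N : ℝ) ^ s := Real.rpow_pos_of_pos hN0 s
  rw [rescaledFactor, kernelFactor, jacobiCoeff, growthFactor, Real.rpow_add_natCast hN0.ne',
    pow_right_comm]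
  field_simp

lemma tendsto_rescaledFactor {s : ℝ} (hs : 0 < s) (k : ℕ) :
    Tendsto (rescaledFactor s · k) atTop (𝓝 ((-1) ^ k / (k.factorial * Real.Gamma (s + k)))) := by
  have hchoose : Tendsto (fun N : ℕ => N.choose k / (N : ℝ) ^ k) atTop
      (𝓝 (1 / k.factorial)) := by
    have hinv : Tendsto (fun N : ℕ => (N : ℝ) * (N : ℝ)⁻¹) atTop (𝓝 1) :=
      tendsto_const_nhds.congr' ((eventually_ne_atTop 0).mono fun N hN =>
        (mul_inv_cancel₀ (Nat.cast_ne_zero.2 hN)).symm)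
    simpa [div_eq_mul_inv] using ProbabilityTheory.tendsto_choose_mul_pow_atTop k hinv
  have hratio : Tendsto (fun N : ℕ => ((N : ℝ) - k) / N) atTop (𝓝 1) := by
    have hsub := (tendsto_const_div_atTop_nhds_zero_nat (k : ℝ)).const_sub 1
    rw [sub_zero] at hsub
    refine hsub.congr' ((eventually_ne_atTop 0).mono fun N hN => ?_)
    rw [← div_self (Nat.cast_ne_zero.2 hN : (N : ℝ) ≠ 0), ← sub_div]
  have hlim := ((hchoose.const_mul ((-1) ^ k)).mul hratio).mul
    (tendsto_growthFactor (by positivity : 0 < s + k))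
  refine (hlim.congr fun N => (rescaledFactor_eq s N k).symm).trans_eq ?_
  rw [mul_one, mul_one_div, ← div_eq_mul_inv, div_div]

lemma exists_abs_rescaledFactor_le {s : ℝ} (hs : 0 < s) :
    ∃ C : ℝ, ∀ N k, |rescaledFactor s N k| ≤ C * ((1 + s⁻¹) ^ k / k.factorial) := by
  obtain ⟨C, hC⟩ := (tendsto_growthFactor hs).bddAbove_range
  have hC0 : 0 ≤ C := (growthFactor_nonneg hs 0).trans (hC (mem_range_self 0))
  refine ⟨C, fun N k => ?_⟩
  rcases le_or_gt N k with hk | hk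
  · rw [rescaledFactor_eq_zero_of_le s hk, abs_zero]
    positivity
  have hN0 : (0 : ℝ) < N := Nat.cast_pos.2 (k.zero_le.trans_lt hk)
  have hk' : (0 : ℝ) ≤ N - k := sub_nonneg.2 (Nat.cast_le.2 hk.le)
  have hgrowth0 := growthFactor_nonneg (by positivity : 0 < s + k) N
  have hgrowth : growthFactor (s + k) N ≤ C * (1 + s⁻¹) ^ k :=
    (growthFactor_add_natCast_le hs N k).trans (by gcongr; exact hC (mem_range_self N))
  have hchoose : N.choose k / (N : ℝ) ^ k ≤ 1 / k.factorial := by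
    rw [div_le_iff₀ (by positivity), one_div_mul_eq_div]
    exact Nat.choose_le_pow_div k N
  have hratio : ((N : ℝ) - k) / N ≤ 1 := by
    rw [div_le_one hN0]
    exact sub_le_self _ k.cast_nonneg
  rw [rescaledFactor_eq, mul_assoc, mul_assoc, abs_mul, abs_pow, abs_neg, abs_one, one_pow,
    one_mul, abs_of_nonneg (by positivity)]
  calc _ ≤ 1 / (k.factorial : ℝ) * (1 * (C * (1 + s⁻¹) ^ k)) := by gcongr
    _ = _ := by ring

lemma gammaMonomial_div_rpow (c : ℝ) {θ x : ℝ} (hθ : θ ≠ 0) (hx : 0 ≤ x) (N k : ℕ) :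
    gammaMonomial c θ (x / (N : ℝ) ^ (2 / θ)) k = gammaMonomial c θ x k / ((N : ℝ) ^ 2) ^ k := by
  rw [gammaMonomial, gammaMonomial, Real.div_rpow hx (by positivity),
    ← Real.rpow_mul N.cast_nonneg, div_mul_cancel₀ _ hθ, Real.rpow_two, div_pow, div_right_comm]

lemma exists_abs_gammaMonomial_le (c : ℝ) {θ x : ℝ} (hθ : 0 ≤ θ) (hx : 0 ≤ x) :
    ∃ M : ℝ, ∀ k, |gammaMonomial c θ x k| ≤ M * (x ^ θ) ^ k := by
  obtain ⟨M, -, hM⟩ := exists_norm_inv_Gamma_le_const (c + 1) 0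
  refine ⟨M, fun k => ?_⟩
  have hGamma := hM (c + k * θ + 1 : ℝ)
    (by rw [Complex.ofReal_re, add_right_comm]; exact le_add_of_nonneg_right (by positivity))
    (by simp)
  rw [Complex.Gamma_ofReal, norm_inv, Complex.norm_real, Real.norm_eq_abs] at hGamma
  have hpow : 0 ≤ (x ^ θ) ^ k := by positivity
  rw [gammaMonomial, abs_div, abs_of_nonneg hpow, div_eq_inv_mul]
  gcongr

lemma exists_summable_bound_rescaledFactor_mul_gammaMonomial {s θ x : ℝ} (hs : 0 < s) (c : ℝ)
    (hθ : 0 ≤ θ) (hx : 0 ≤ x) :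
    ∃ U : ℕ → ℝ, Summable U ∧ ∀ N k, |rescaledFactor s N k * gammaMonomial c θ x k| ≤ U k := by
  obtain ⟨C, hC⟩ := exists_abs_rescaledFactor_le hs
  obtain ⟨M, hM⟩ := exists_abs_gammaMonomial_le c hθ hx
  refine ⟨fun k => C * M * (((1 + s⁻¹) * x ^ θ) ^ k / k.factorial),
    (Real.summable_pow_div_factorial _).mul_left _, fun N k => ?_⟩
  rw [abs_mul]
  refine (mul_le_mul (hC N k) (hM k) (abs_nonneg _) ((abs_nonneg _).trans (hC N k))).trans_eq ?_
  simp only [mul_pow]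
  ring

lemma tendsto_rescaledFactor_mul_gammaMonomial {α : ℝ} (hα : 0 < α + 1) (θ c x : ℝ) (k : ℕ) :
    Tendsto (fun N => ((rescaledFactor (α + 1) N k * gammaMonomial c θ x k : ℝ) : ℂ)) atTop
      (𝓝 (gTerm θ α c (x ^ θ : ℝ) k)) := by
  have hlim := (tendsto_rescaledFactor hα k).mul_const (gammaMonomial c θ x k)
  refine ((Complex.continuous_ofReal.tendsto _).comp hlim).trans_eq ?_
  rw [gTerm, gammaMonomial]
  push_cast [← Complex.Gamma_ofReal]
  rw [add_right_comm (α : ℂ), mul_comm (k : ℂ), div_mul_div_comm, mul_assoc]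

lemma tendsto_tsum_mul_div {ι : Type*} [Nonempty ι] {l : Filter ι} {s : ℝ} (hs : 0 < s)
    {u v : ι → ℕ → ℂ} {u' v' : ℕ → ℂ} {U V : ℕ → ℝ} (hU : Summable U) (hV : Summable V)
    (hu : ∀ i k, ‖u i k‖ ≤ U k) (hv : ∀ i k, ‖v i k‖ ≤ V k)
    (hu' : ∀ k, Tendsto (u · k) l (𝓝 (u' k))) (hv' : ∀ k, Tendsto (v · k) l (𝓝 (v' k))) :
    Tendsto (fun i => ∑' p : ℕ × ℕ, u i p.1 * v i p.2 / (s + p.1 + p.2)) l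
      (𝓝 (∑' p : ℕ × ℕ, u' p.1 * v' p.2 / (s + p.1 + p.2))) := by
  obtain ⟨i₀⟩ := ‹Nonempty ι›
  have hbound : Summable fun p : ℕ × ℕ => U p.1 * V p.2 / s :=
    (hU.mul_of_nonneg hV (fun k => (norm_nonneg _).trans (hu i₀ k))
      fun k => (norm_nonneg _).trans (hv i₀ k)).div_const s
  refine tendsto_tsum_of_dominated_convergence hbound
    (fun p => ((hu' p.1).mul (hv' p.2)).div_const _) (.of_forall fun i p => ?_)
  have hden : s ≤ ‖(s + p.1 + p.2 : ℂ)‖ := by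
    have hcast : (s + p.1 + p.2 : ℂ) = (s + p.1 + p.2 : ℝ) := by push_cast; rfl
    rw [hcast, Complex.norm_real, Real.norm_of_nonneg (by positivity), add_assoc]
    exact le_add_of_nonneg_right (by positivity)
  rw [norm_div, norm_mul]
  have hU0 := (norm_nonneg _).trans (hu i p.1)
  have hV0 := (norm_nonneg _).trans (hv i p.2)
  gcongr
  exacts [hu i p.1, hv i p.2]

variable {a b θ : ℝ} {P Q : ℕ → Polynomial ℝ} {X Y : ℝ}

lemma IsBiorthogonal.rpow_mul_cdKernel_eq_tsum (hPQ : IsBiorthogonal a b θ P Q) (hθ : 0 < θ)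
    (ha : -1 < a) (hb : -1 < b) (hab : 0 < a + b + 1) (hX : 0 ≤ X) (hY : 0 ≤ Y) (N : ℕ) :
    (N : ℝ) ^ (-2 * (alpha a b θ + 1)) *
        cdKernel a b θ P Q N (X / (N : ℝ) ^ (2 / θ)) (Y / (N : ℝ) ^ (2 / θ)) =
      θ * ∑' p : ℕ × ℕ, rescaledFactor (alpha a b θ + 1) N p.1 * gammaMonomial a θ X p.1 *
        (rescaledFactor (alpha a b θ + 1) N p.2 * gammaMonomial b θ Y p.2) /
          (alpha a b θ + 1 + p.1 + p.2) := by
  set s := alpha a b θ + 1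
  have hsupport : ∀ p ∉ Finset.range N ×ˢ Finset.range N,
      rescaledFactor s N p.1 * gammaMonomial a θ X p.1 *
        (rescaledFactor s N p.2 * gammaMonomial b θ Y p.2) / (s + p.1 + p.2) = 0 := by
    intro p hp
    simp only [Finset.mem_product, Finset.mem_range, not_and_or, not_lt] at hp
    rcases hp with hp | hp <;> simp [rescaledFactor_eq_zero_of_le s hp]
  have hpow : (N : ℝ) ^ (-2 * s) = ((N : ℝ) ^ s)⁻¹ * ((N : ℝ) ^ s)⁻¹ := by
    rw [mul_comm, Real.rpow_mul N.cast_nonneg, ← mul_inv, ← sq]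
    exact_mod_cast Real.rpow_neg_natCast ((N : ℝ) ^ s) 2
  rw [tsum_eq_sum hsupport, Finset.sum_product, hPQ.cdKernel_eq_sum hθ ha hb hab, mul_left_comm,
    Finset.mul_sum]
  refine congrArg (θ * ·) (Finset.sum_congr rfl fun k _ => ?_)
  rw [Finset.mul_sum]
  refine Finset.sum_congr rfl fun l _ => ?_
  rw [gammaMonomial_div_rpow a hθ.ne' hX, gammaMonomial_div_rpow b hθ.ne' hY, hpow,
    rescaledFactor, rescaledFactor]
  simp only [div_eq_mul_inv, mul_inv]
  ring

lemma IsBiorthogonal.tendsto_rpow_mul_cdKernel (hPQ : IsBiorthogonal a b θ P Q) (hθ : 0 < θ)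
    (ha : -1 < a) (hb : -1 < b) (hab : 0 < a + b + 1) (hX : 0 ≤ X) (hY : 0 ≤ Y) :
    Tendsto (fun N : ℕ => (((N : ℝ) ^ (-2 * (alpha a b θ + 1)) *
        cdKernel a b θ P Q N (X / (N : ℝ) ^ (2 / θ)) (Y / (N : ℝ) ^ (2 / θ)) : ℝ) : ℂ)) atTop
      (𝓝 (θ * ∑' p : ℕ × ℕ, gTerm θ (alpha a b θ) a (X ^ θ : ℝ) p.1 *
        gTerm θ (alpha a b θ) b (Y ^ θ : ℝ) p.2 / ((alpha a b θ + 1 : ℝ) + p.1 + p.2))) := by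
  have hs := alpha_add_one_pos hθ hab
  obtain ⟨U, hU, hUbound⟩ :=
    exists_summable_bound_rescaledFactor_mul_gammaMonomial hs a hθ.le hX
  obtain ⟨V, hV, hVbound⟩ :=
    exists_summable_bound_rescaledFactor_mul_gammaMonomial hs b hθ.le hY
  have hlim := (tendsto_tsum_mul_div hs hU hV
    (fun N k => (Complex.norm_real _).trans_le (hUbound N k))
    (fun N k => (Complex.norm_real _).trans_le (hVbound N k))
    (tendsto_rescaledFactor_mul_gammaMonomial hs θ a X)
    (tendsto_rescaledFactor_mul_gammaMonomial hs θ b Y)).const_mul (θ : ℂ)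
  refine hlim.congr fun N => ?_
  rw [hPQ.rpow_mul_cdKernel_eq_tsum hθ ha hb hab hX hY, Complex.ofReal_mul, Complex.ofReal_tsum]
  push_cast
  rfl

end KernelAsymptotics

section TermwiseIntegration

variable {f g : ℕ → ℂ} {α : ℝ}

lemma norm_mul_ofReal_pow_le (z : ℂ) {t : ℝ} (ht : t ∈ uIcc 0 1) (k : ℕ) :
    ‖z * (t : ℂ) ^ k‖ ≤ ‖z‖ := by
  rw [uIcc_of_le zero_le_one] at ht
  rw [norm_mul, norm_pow, Complex.norm_real, Real.norm_of_nonneg ht.1]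
  exact mul_le_of_le_one_right (norm_nonneg z) (pow_le_one₀ ht.1 ht.2)

lemma summable_norm_mul_ofReal_pow (hf : Summable fun k => ‖f k‖) {t : ℝ} (ht : t ∈ uIcc 0 1) :
    Summable fun k => ‖f k * (t : ℂ) ^ k‖ :=
  hf.of_nonneg_of_le (fun _ => norm_nonneg _) fun k => norm_mul_ofReal_pow_le (f k) ht k

lemma hasSum_mul_tsum_mul_tsum (c : ℂ) (hf : Summable fun k => ‖f k‖)
    (hg : Summable fun k => ‖g k‖) :
    HasSum (fun p : ℕ × ℕ => c * (f p.1 * g p.2)) (c * (∑' k, f k) * ∑' k, g k) := by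
  rw [mul_assoc, tsum_mul_tsum_of_summable_norm hf hg]
  exact (summable_mul_of_summable_norm hf hg).hasSum.mul_left c

lemma continuousOn_tsum_mul_pow (hf : Summable fun k => ‖f k‖) :
    ContinuousOn (fun t : ℝ => ∑' k, f k * (t : ℂ) ^ k) (uIcc 0 1) :=
  continuousOn_tsum (fun k => by fun_prop) hf fun k _ ht => norm_mul_ofReal_pow_le (f k) ht k

lemma intervalIntegrable_rpow_mul_tsum_mul_tsum (hα : -1 < α) (hf : Summable fun k => ‖f k‖)
    (hg : Summable fun k => ‖g k‖) :
    IntervalIntegrable (fun t : ℝ => ((t ^ α : ℝ) : ℂ) * (∑' k, f k * (t : ℂ) ^ k) *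
      ∑' k, g k * (t : ℂ) ^ k) volume 0 1 :=
  have hrpow : IntervalIntegrable (fun t : ℝ => t ^ α) volume 0 1 :=
    intervalIntegral.intervalIntegrable_rpow' hα
  (IntervalIntegrable.mul_continuousOn ⟨hrpow.1.ofReal, hrpow.2.ofReal⟩
    (continuousOn_tsum_mul_pow hf)).mul_continuousOn (continuousOn_tsum_mul_pow hg)

lemma integral_rpow_mul_pow_mul_pow (hα : -1 < α) (k l : ℕ) :
    ∫ t in (0 : ℝ)..1, ((t ^ α * t ^ k * t ^ l : ℝ) : ℂ) = (((α + 1 : ℝ) + k + l : ℂ))⁻¹ := by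
  have hexp : -1 < α + k + l := by
    have : (0 : ℝ) ≤ k + l := by positivity
    linarith
  have hcongr : ∫ t in (0 : ℝ)..1, t ^ α * t ^ k * t ^ l = ∫ t in (0 : ℝ)..1, t ^ (α + k + l) := by
    refine intervalIntegral.integral_congr_uIoo fun t ht => ?_
    rw [uIoo_of_le zero_le_one] at ht
    simp only [Real.rpow_add ht.1, Real.rpow_natCast]
  rw [intervalIntegral.integral_ofReal, hcongr, integral_rpow (.inl hexp), Real.one_rpow,
    Real.zero_rpow (by linarith), sub_zero, one_div]
  push_cast
  ring

lemma integral_rpow_mul_tsum_mul_tsum (hα : -1 < α) (hf : Summable fun k => ‖f k‖)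
    (hg : Summable fun k => ‖g k‖) :
    ∫ t in (0 : ℝ)..1, ((t ^ α : ℝ) : ℂ) * (∑' k, f k * (t : ℂ) ^ k) *
        ∑' k, g k * (t : ℂ) ^ k =
      ∑' p : ℕ × ℕ, f p.1 * g p.2 / ((α + 1 : ℝ) + p.1 + p.2) := by
  have hrpow : IntervalIntegrable (fun t : ℝ => t ^ α) volume 0 1 :=
    intervalIntegral.intervalIntegrable_rpow' hα
  have hfg := hf.mul_of_nonneg hg (fun _ => norm_nonneg _) fun _ => norm_nonneg _
  have hseries : HasSum (fun p : ℕ × ℕ => ∫ t in (0 : ℝ)..1,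
        ((t ^ α : ℝ) : ℂ) * (f p.1 * (t : ℂ) ^ p.1 * (g p.2 * (t : ℂ) ^ p.2)))
      (∫ t in (0 : ℝ)..1, ((t ^ α : ℝ) : ℂ) * (∑' k, f k * (t : ℂ) ^ k) *
        ∑' k, g k * (t : ℂ) ^ k) := by
    refine intervalIntegral.hasSum_integral_of_dominated_convergence
      (fun p t => t ^ α * (‖f p.1‖ * ‖g p.2‖))
      (fun p => Measurable.aestronglyMeasurable (by fun_prop))
      (fun p => .of_forall fun t ht => ?_) (.of_forall fun t _ => hfg.mul_left _)
      (by simpa only [tsum_mul_left] using hrpow.mul_const _) (.of_forall fun t ht => ?_)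
    · have ht0 : 0 ≤ t ^ α := Real.rpow_nonneg (uIoc_of_le (zero_le_one' ℝ) ▸ ht).1.le α
      rw [norm_mul, norm_mul, Complex.norm_real, Real.norm_of_nonneg ht0]
      gcongr <;> exact norm_mul_ofReal_pow_le _ (uIoc_subset_uIcc ht) _
    · have hft := summable_norm_mul_ofReal_pow hf (uIoc_subset_uIcc ht)
      have hgt := summable_norm_mul_ofReal_pow hg (uIoc_subset_uIcc ht)
      have hprod := hasSum_mul_tsum_mul_tsum (t ^ α : ℝ) hft hgt
      exact hprod
  rw [← hseries.tsum_eq]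
  refine tsum_congr fun p => ?_
  rw [div_eq_mul_inv, ← integral_rpow_mul_pow_mul_pow hα, ← intervalIntegral.integral_const_mul]
  congr 1 with t
  push_cast
  ring

end TermwiseIntegration

section HardEdge

variable {γ : LeftLoop} {θ α x y : ℝ}

lemma gTerm_ofReal_mul (θ α c t x : ℝ) (k : ℕ) :
    gTerm θ α c (t * x : ℝ) k = gTerm θ α c x k * (t : ℂ) ^ k := by
  rw [gTerm, gTerm, Complex.ofReal_mul, mul_pow]
  ring

lemma gInf_ofReal_mul (hθ : 0 ≤ θ) (α c : ℝ) (hx : x ≠ 0) (hγ : γ.Encloses 0) {t : ℝ}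
    (ht : t ≠ 0) :
    gInf γ θ α c (t * x : ℝ) = ∑' k, gTerm θ α c x k * (t : ℂ) ^ k := by
  have hsum := hasSum_gTerm hθ α c (Complex.ofReal_ne_zero.2 (mul_ne_zero ht hx)) hγ
  simpa only [gTerm_ofReal_mul] using hsum.tsum_eq.symm

lemma rpow_mul_gInf_mul_gInf (hθ : 0 ≤ θ) (α a b : ℝ) (hx : x ≠ 0) (hy : y ≠ 0)
    (hγ : γ.Encloses 0) :
    EqOn (fun t : ℝ => ((t ^ α : ℝ) : ℂ) * (∑' k, gTerm θ α a x k * (t : ℂ) ^ k) *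
        ∑' k, gTerm θ α b y k * (t : ℂ) ^ k)
      (fun t : ℝ => ((t ^ α : ℝ) : ℂ) * gInf γ θ α a (t * x : ℝ) * gInf γ θ α b (t * y : ℝ))
      (uIoc 0 1) := by
  intro t ht
  rw [uIoc_of_le zero_le_one] at ht
  simp only [gInf_ofReal_mul hθ α _ hx hγ ht.1.ne', gInf_ofReal_mul hθ α _ hy hγ ht.1.ne']

lemma intervalIntegrable_rpow_mul_gInf_mul_gInf (hθ : 0 ≤ θ) (hα : -1 < α) (a b : ℝ) (hx : x ≠ 0)
    (hy : y ≠ 0) (hγ : γ.Encloses 0) :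
    IntervalIntegrable (fun t : ℝ => ((t ^ α : ℝ) : ℂ) * gInf γ θ α a (t * x : ℝ) *
      gInf γ θ α b (t * y : ℝ)) volume 0 1 :=
  (intervalIntegrable_rpow_mul_tsum_mul_tsum hα
    (summable_norm_gTerm hθ α a (Complex.ofReal_ne_zero.2 hx))
    (summable_norm_gTerm hθ α b (Complex.ofReal_ne_zero.2 hy))).congr
    (rpow_mul_gInf_mul_gInf hθ α a b hx hy hγ)

lemma integral_rpow_mul_gInf_mul_gInf (hθ : 0 ≤ θ) (hα : -1 < α) (a b : ℝ) (hx : x ≠ 0)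
    (hy : y ≠ 0) (hγ : γ.Encloses 0) :
    ∫ t in (0 : ℝ)..1, ((t ^ α : ℝ) : ℂ) * gInf γ θ α a (t * x : ℝ) * gInf γ θ α b (t * y : ℝ) =
      ∑' p : ℕ × ℕ, gTerm θ α a x p.1 * gTerm θ α b y p.2 / ((α + 1 : ℝ) + p.1 + p.2) := by
  rw [← integral_rpow_mul_tsum_mul_tsum hα
    (summable_norm_gTerm hθ α a (Complex.ofReal_ne_zero.2 hx))
    (summable_norm_gTerm hθ α b (Complex.ofReal_ne_zero.2 hy))]
  exact intervalIntegral.integral_congr_ae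
    (.of_forall (rpow_mul_gInf_mul_gInf hθ α a b hx hy hγ).symm)

end HardEdge

end CauchyLaguerre

open CauchyLaguerre in
theorem mainTheorem4_general (θ a b : ℝ) (hθ : 0 < θ) (ha : -1 < a) (hb : -1 < b)
    (hab : 0 < a + b + 1) :
    (∃ P Q : ℕ → Polynomial ℝ, IsBiorthogonal a b θ P Q) ∧
    ∀ γ : LeftLoop, γ.Encloses 0 →
      (∀ (c : ℝ) (z : ℂ), z ≠ 0 →
        γ.Integrable (gIntegrand θ (alpha a b θ) c z) ∧
        HasSum (fun k : ℕ => (-1) ^ k * z ^ k /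
            ((k.factorial : ℂ) *
              Complex.Gamma ((alpha a b θ : ℂ) + k + 1) *
              Complex.Gamma ((c : ℂ) + θ * k + 1)))
          (gInf γ θ (alpha a b θ) c z) ∧
        FoxSuitable 1 0 ![] ![] ![0, -(alpha a b θ : ℂ), -(c : ℂ)] ![1, 1, θ] z γ ∧
        gInf γ θ (alpha a b θ) c z =
          foxH 1 0 ![] ![] ![0, -(alpha a b θ : ℂ), -(c : ℂ)] ![1, 1, θ] γ z) ∧
      ∀ X Y : ℝ, 0 < X → 0 < Y →
        IntervalIntegrable (fun t : ℝ =>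
            ((t ^ alpha a b θ : ℝ) : ℂ) *
              gInf γ θ (alpha a b θ) a ((t * X ^ θ : ℝ) : ℂ) *
              gInf γ θ (alpha a b θ) b ((t * Y ^ θ : ℝ) : ℂ))
          volume 0 1 ∧
        ∀ P Q : ℕ → Polynomial ℝ, IsBiorthogonal a b θ P Q →
          Tendsto (fun N : ℕ =>
              (((N : ℝ) ^ (-2 * (alpha a b θ + 1)) *
                cdKernel a b θ P Q N
                  (X / (N : ℝ) ^ (2 / θ)) (Y / (N : ℝ) ^ (2 / θ)) : ℝ) : ℂ))
            atTop
            (𝓝 ((θ : ℂ) * ∫ t in (0 : ℝ)..1,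
              ((t ^ alpha a b θ : ℝ) : ℂ) *
                gInf γ θ (alpha a b θ) a ((t * X ^ θ : ℝ) : ℂ) *
                gInf γ θ (alpha a b θ) b ((t * Y ^ θ : ℝ) : ℂ))) := by
  have hα : -1 < alpha a b θ := by linarith [alpha_add_one_pos hθ hab]
  refine ⟨⟨_, _, isBiorthogonal_jacobiTransform hθ ha hb hab⟩,
    fun γ hγ => ⟨fun c z hz => ⟨integrable_gIntegrand hθ.le _ c hz hγ, hasSum_gTerm hθ.le _ c hz hγ,
      foxSuitable_of_encloses_zero hθ.le _ c hz hγ, ?_⟩, fun X Y hX hY => ?_⟩⟩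
  · rw [foxH, foxIntegrand_eq_gIntegrand, gInf]
  have hξ : X ^ θ ≠ 0 := (Real.rpow_pos_of_pos hX θ).ne'
  have hη : Y ^ θ ≠ 0 := (Real.rpow_pos_of_pos hY θ).ne'
  refine ⟨intervalIntegrable_rpow_mul_gInf_mul_gInf hθ.le hα a b hξ hη hγ, fun P Q hPQ => ?_⟩
  rw [integral_rpow_mul_gInf_mul_gInf hθ.le hα a b hξ hη hγ]
  exact hPQ.tendsto_rpow_mul_cdKernel hθ ha hb hab hX.le hY.le

theorem mainTheorem4 (θ a b : ℝ) (hθ : 0 < θ) (ha : -1 < a) (hb : -1 < b)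
    (hab : 0 < a + b + 1) :
    (∃ P Q : ℕ → Polynomial ℝ, CauchyLaguerre.IsBiorthogonal a b θ P Q) ∧
    ∀ γ : CauchyLaguerre.LeftLoop, (∀ x : ℝ, x ≤ 0 → γ.Encloses (x : ℂ)) →
      (∀ c : ℝ, -1 < c → ∀ z : ℂ, z ≠ 0 →
        γ.Integrable (CauchyLaguerre.gIntegrand θ (CauchyLaguerre.alpha a b θ) c z) ∧
        HasSum (fun k : ℕ => (-1) ^ k * z ^ k /
            ((k.factorial : ℂ) *
              Complex.Gamma ((CauchyLaguerre.alpha a b θ : ℂ) + k + 1) *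
              Complex.Gamma ((c : ℂ) + θ * k + 1)))
          (CauchyLaguerre.gInf γ θ (CauchyLaguerre.alpha a b θ) c z) ∧
        CauchyLaguerre.FoxSuitable 1 0 ![] ![]
          ![0, -(CauchyLaguerre.alpha a b θ : ℂ), -(c : ℂ)] ![1, 1, θ] z γ ∧
        CauchyLaguerre.gInf γ θ (CauchyLaguerre.alpha a b θ) c z =
          CauchyLaguerre.foxH 1 0 ![] ![]
            ![0, -(CauchyLaguerre.alpha a b θ : ℂ), -(c : ℂ)] ![1, 1, θ] γ z) ∧
      ∀ X Y : ℝ, 0 < X → 0 < Y →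
        IntervalIntegrable (fun t : ℝ =>
            ((t ^ CauchyLaguerre.alpha a b θ : ℝ) : ℂ) *
              CauchyLaguerre.gInf γ θ (CauchyLaguerre.alpha a b θ) a ((t * X ^ θ : ℝ) : ℂ) *
              CauchyLaguerre.gInf γ θ (CauchyLaguerre.alpha a b θ) b ((t * Y ^ θ : ℝ) : ℂ))
          volume 0 1 ∧
        ∀ P Q : ℕ → Polynomial ℝ, CauchyLaguerre.IsBiorthogonal a b θ P Q →
          Tendsto (fun N : ℕ =>
              (((N : ℝ) ^ (-2 * (CauchyLaguerre.alpha a b θ + 1)) *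
                CauchyLaguerre.cdKernel a b θ P Q N
                  (X / (N : ℝ) ^ (2 / θ)) (Y / (N : ℝ) ^ (2 / θ)) : ℝ) : ℂ))
            atTop
            (𝓝 ((θ : ℂ) * ∫ t in (0 : ℝ)..1,
              ((t ^ CauchyLaguerre.alpha a b θ : ℝ) : ℂ) *
                CauchyLaguerre.gInf γ θ (CauchyLaguerre.alpha a b θ) a ((t * X ^ θ : ℝ) : ℂ) *
                CauchyLaguerre.gInf γ θ (CauchyLaguerre.alpha a b θ) b
                  ((t * Y ^ θ : ℝ) : ℂ))) := by
  have hmain := mainTheorem4_general θ a b hθ ha hb hab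
  exact ⟨hmain.1, fun γ hγ => ⟨fun c _ => (hmain.2 γ (by simpa using hγ 0 le_rfl)).1 c,
    (hmain.2 γ (by simpa using hγ 0 le_rfl)).2⟩⟩
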